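/- Addresses are finite words of natural numbers, and ramifications are finite sets of natural numbers; $\xi\star J=\{\xi j\mid j\in J\}$. A finite set of addresses is well formed if none of its elements is a prefix of another one. Positive and negative pseudo-designs are the (possibly infinite) trees given by $$\phi::=\Omega\mid\maltese\mid(+,\xi,I)\cdot\{\psi_{\xi i}\mid i\in I\},\qquad \psi_\zeta::=\{(-,\zeta,J)\phi_J\mid J\in\mathcal P_f(\omega)\}.$$ Typing, by possibly infinite derivations: $\Omega$ and $\maltese$ have type $(\vdash\Lambda)$ for every well-formed $\Lambda$; $(+,\xi,I)\cdot\{\psi_{\xi i}\mid i\in I\}:(\vdash\xi,\Lambda)$ if $\xi,\Lambda$ is well formed and $\psi_{\xi i}:(\xi i\vdash\Lambda_i)$ for pairwise disjoint $\Lambda_i\subseteq\Lambda$; $\{(-,\zeta,J)\phi_J\}_J:(\zeta\vdash\Lambda)$ if $\zeta,\Lambda$ is well formed and, for every $J$, $\phi_J:(\vdash\zeta\star J,\Lambda_J)$ for some $\Lambda_J\subseteq\Lambda$. A design is a typable pseudo-design different from $\Omega$. A slice is a design in which, for each negative focus above a given positive action (and for the root of a negative design), at most one ramification $J$ is such that $(-,\zeta,J)$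 is followed by something other than $\Omega$. We write $\phi_0\subseteq\phi$ if $\phi$ is obtained from $\phi_0$ by replacing occurrences of $\Omega$ by trees. The chronicles of a positive design are its branches, from the root, that end with a positive action different from $\Omega$. States $\langle\phi\mid\Psi\rangle_q$ ($\Psi$ a finite set of negative pseudo-designs with distinct foci, $q$ a sequence of actions) evolve by (R) $\langle(+,\xi,I)\cdot\Psi'\mid\Psi\rangle_q\to\langle\Psi_{\xi,I}\mid\Psi'\cup(\Psi\setminus\xi)\rangle_q$ if $\Psi$ contains a design $\Psi_\xi$ of focus $\xi$, where $\Psi_{\xi,I}$ is the tree above $(-,\xi,I)$ in $\Psi_\xi$; (S) $\langle(+,\xi,I)\cdot\Psi'\mid\Psi\rangle_q\to\langle\Psi'_{\xi i,J}\mid\Psi\rangle_{q(+,\xi,I)(-,\xi i,J)}$ otherwise, for any $i\in I$ and any $J$. The normal form $[\![\phi,\psi]\!]$ is the set of the chronicles $q\kappa$ such that a state of index $q$ is reachable from $\langle\phi\mid\{\psi\}\rangle_\epsilon$ and either has head $\kappa\in\{\Omega,\maltese\}$, or has a head $\kappa=(+,\xi,I)$ with $\xi$ not the focus of an element of its environment,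 or $\kappa=\Omega$ and the state has an infinite sequence of (R)-transitions. Token machine. A token starts at the root of $\phi$ and moves on the occurrences of actions of $\phi$ and $\psi$, where $\xi$ is the focus of $\psi$; the machine maintains a set of bindings (pairs of an occurrence of a positive action and an occurrence of a negative one) and an index $q$, both initially empty. From a negative occurrence the token moves to the positive occurrence right above it. From an occurrence $u$ of a positive action $(+,\zeta,I)$ it moves as follows. If $u$ is in $\phi$ and $\zeta=\xi$, it moves to the initial action $(-,\xi,I)$ of $\psi$. If $\zeta=\zeta' i$ and an occurrence $v$ of a negative action of focus $\zeta'$ on the branch below $u$ is bound to a positive occurrence $v'$, it moves to the negative occurrence $(-,\zeta,I)$ right above $v'$. In both cases, $u$ becomes bound to the negative occurrence reached. Otherwise the token moves, for freely chosen $i\in I$ and $J$, to the occurrence $(-,\zeta i,J)$ right above $u$, and $(+,\zeta,I)(-,\zeta i,J)$ is appended to the index. For a set $R$ of chronicles, the exploration of $R$ consists of all the runs of this machine whose index stays a prefix of an element of $R$. Let $\phi:(\vdash\xi,\Lambda_1)$ and $\psi:(\xi\vdash\Lambda_2)$, where $\xi\notin\Lambda_1$, $\Lambda_1\cap\Lambda_2=\emptyset$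 and $\{\xi\}\cup\Lambda_1\cup\Lambda_2$ is well formed. The pull-back of a set $R$ of chronicles of $[\![\phi,\psi]\!]$ is the minimum pair $(\phi_0,\psi_0)$ with $\phi_0\subseteq\phi$, $\psi_0\subseteq\psi$ and $R\subseteq[\![\phi_0,\psi_0]\!]$. **Proposition.** (1) If $(\phi_0,\psi_0)$ is the pull-back of (the singleton of) a chronicle $r\in[\![\phi,\psi]\!]$, $r\neq\Omega$, then $\phi_0$ and $\psi_0$ are slices. (2) More generally, if $S$ is a positive slice all of whose chronicles belong to $[\![\phi,\psi]\!]$, and $(\phi_0,\psi_0)$ is the pull-back of the set of chronicles of $S$, then $\phi_0$ and $\psi_0$ are slices. (3) In both cases, each occurrence of an action in $\phi_0$ or $\psi_0$ (not counting $\Omega$, nor negative actions followed by $\Omega$) is visited exactly once during the exploration of $\{r\}$, respectively of the chronicles of $S$, by the token machine run on $\phi$ and $\psi$: there are exactly one time $k$ and one configuration reached after $k$ moves in which the token is at that occurrence. -/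

import Mathlib

namespace Ludics

/-- Addresses (loci): finite words of natural numbers. The address `ξi` is `ξ ++ [i]`. -/
abbrev Address := List ℕ

/-- Ramifications: finite sets of natural numbers. -/
abbrev Ram := Finset ℕ

/-- `ξ ⋆ J = {ξj | j ∈ J}`. -/
def locusStar (ξ : Address) (J : Ram) : Finset Address := J.image (fun j => ξ ++ [j])

/-- The addresses of `Λ` are pairwise disjoint: none is a prefix of a different one. -/
def WellFormed (Λ : Finset Address) : Prop := ∀ a ∈ Λ, ∀ b ∈ Λ, a <+: b → a = b

/-- Positive actions: `Ω`, the daimon, and the proper positive actions `(+,ξ,I)`. -/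
inductive PosAction where
  | omega : PosAction
  | daimon : PosAction
  | proper (ξ : Address) (I : Ram) : PosAction

/-- Actions: the positive ones, and the negative actions `(-,ζ,J)`. -/
inductive Action where
  | pos (κ : PosAction) : Action
  | neg (ζ : Address) (J : Ram) : Action

/-- A path `(i₁,J₁)(i₂,J₂)…` in a positive pseudo-design: it goes through the negative actions
`(-,ξ₁i₁,J₁)`, `(-,ξ₂i₂,J₂)`, …, where `ξ₁, ξ₂, …` are the foci of the positive actions met. -/
abbrev Path := List (ℕ × Ram)

/-- Positive pseudo-designs `φ ::= Ω | ✠ | (+,ξ,I)·{ψ_{ξi} | i ∈ I}`, possibly of infinite depth,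
presented as labelled trees: `head p` is the positive action which sits at the end of the path `p`.
Above a proper positive action `(+,ξ,I)` there is one subtree for each `i ∈ I` and each
ramification `J`; what is not in the tree is labelled `Ω`. -/
@[ext]
structure PosDesign where
  head : Path → PosAction
  tree : ∀ (p : Path) (i : ℕ) (J : Ram), head (p ++ [(i, J)]) ≠ PosAction.omega →
    ∃ (ξ : Address) (I : Ram), head p = PosAction.proper ξ I ∧ i ∈ I

/-- Negative pseudo-designs `ψ_ζ = {(-,ζ,J) φ_J | J}`: `focus` is `ζ` and `branch J` is `φ_J`. -/
@[ext]
structure NegDesign where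
  focus : Address
  branch : Ram → PosDesign

/-- The subtree above the negative action `(-,ξi,J)` which follows the root `(+,ξ,I)` of `φ`. -/
def PosDesign.sub (φ : PosDesign) (i : ℕ) (J : Ram) : PosDesign where
  head p := φ.head ((i, J) :: p)
  tree p j K h := φ.tree ((i, J) :: p) j K h

/-- If `φ = (+,ξ,I)·{ψ_{ξi} | i ∈ I}`, this is `ψ_{ξi}`. -/
def PosDesign.child (φ : PosDesign) (ξ : Address) (i : ℕ) : NegDesign where
  focus := ξ ++ [i]
  branch J := φ.sub i J

/-! ### Typing -/

/-- One typing step for negative pseudo-designs, `ψ : (ζ ⊢ Λ)`, the premises `φ : (⊢ Γ)` being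
read as `R φ Γ`. -/
def NegTypingRule (R : PosDesign → Finset Address → Prop)
    (ψ : NegDesign) (ζ : Address) (Λ : Finset Address) : Prop :=
  ψ.focus = ζ ∧ ζ ∉ Λ ∧ WellFormed (insert ζ Λ) ∧
    ∀ J : Ram, ∃ ΛJ : Finset Address, ΛJ ⊆ Λ ∧ R (ψ.branch J) (locusStar ζ J ∪ ΛJ)

/-- One typing step for positive pseudo-designs, `φ : (⊢ Γ)`. For `Ω` and the daimon, `Γ` is only
required to be well formed; if the root is `(+,ξ,I)`, then `Γ` is `ξ, Λ`, where `Λ` contains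
pairwise disjoint `Λ_i` with `ψ_{ξi} : (ξi ⊢ Λ_i)`. -/
def PosTypingRule (R : PosDesign → Finset Address → Prop)
    (φ : PosDesign) (Γ : Finset Address) : Prop :=
  WellFormed Γ ∧ ∀ (ξ : Address) (I : Ram), φ.head [] = PosAction.proper ξ I →
    ξ ∈ Γ ∧ ∃ Λ : ℕ → Finset Address,
      (∀ i ∈ I, Λ i ⊆ Γ.erase ξ) ∧
      (∀ i ∈ I, ∀ j ∈ I, i ≠ j → Disjoint (Λ i) (Λ j)) ∧
      (∀ i ∈ I, NegTypingRule R (φ.child ξ i) (ξ ++ [i]) (Λ i))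

/-- `φ : (⊢ Γ)`. Since designs may have infinite depth, so may their typing trees: typing is the
greatest relation closed backwards under the typing rules. -/
def PosTyped (φ : PosDesign) (Γ : Finset Address) : Prop :=
  ∃ R : PosDesign → Finset Address → Prop,
    (∀ φ' Γ', R φ' Γ' → PosTypingRule R φ' Γ') ∧ R φ Γ

/-- `ψ : (ζ ⊢ Λ)`. -/
def NegTyped (ψ : NegDesign) (ζ : Address) (Λ : Finset Address) : Prop :=
  NegTypingRule PosTyped ψ ζ Λ

/-- A positive design is a typable positive pseudo-design different from `Ω`. -/
def PosDesign.IsDesign (φ : PosDesign) : Prop :=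
  (∃ Γ, PosTyped φ Γ) ∧ φ.head [] ≠ PosAction.omega

/-- A negative design is a typable negative pseudo-design. -/
def NegDesign.IsDesign (ψ : NegDesign) : Prop :=
  ∃ ζ Λ, NegTyped ψ ζ Λ

/-- Above each positive action and for each `i`, at most one ramification `J` is such that
`(-,ξi,J)` is followed by something else than `Ω`. -/
def PosDesign.Multiplicative (φ : PosDesign) : Prop :=
  ∀ (p : Path) (i : ℕ) (J₁ J₂ : Ram),
    φ.head (p ++ [(i, J₁)]) ≠ PosAction.omega → φ.head (p ++ [(i, J₂)]) ≠ PosAction.omega → J₁ = J₂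

/-- Slices: designs in which two chronicles `r(-,ξ,I₁)`, `r(-,ξ,I₂)` always have `I₁ = I₂`. -/
def PosDesign.IsSlice (φ : PosDesign) : Prop :=
  φ.IsDesign ∧ φ.Multiplicative

/-- Negative slices. -/
def NegDesign.IsSlice (ψ : NegDesign) : Prop :=
  ψ.IsDesign ∧
    (∀ J₁ J₂ : Ram, (ψ.branch J₁).head [] ≠ PosAction.omega →
      (ψ.branch J₂).head [] ≠ PosAction.omega → J₁ = J₂) ∧
    ∀ J, (ψ.branch J).Multiplicative

/-- The stable ordering on positive pseudo-designs: information is increased by replacing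
occurrences of `Ω` by trees. -/
instance : HasSubset PosDesign where
  Subset φ φ' := ∀ p, φ.head p = PosAction.omega ∨ φ.head p = φ'.head p

/-- The stable ordering on negative pseudo-designs. -/
instance : HasSubset NegDesign where
  Subset ψ ψ' := ψ.focus = ψ'.focus ∧ ∀ J, ψ.branch J ⊆ ψ'.branch J

/-- The chronicles of a positive pseudo-design: its branches ending with a positive action
different from `Ω`. -/
inductive PosDesign.IsChronicle : PosDesign → List Action → Prop where
  | daimon (φ : PosDesign) (h : φ.head [] = PosAction.daimon) :
      PosDesign.IsChronicle φ [Action.pos PosAction.daimon]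
  | proper (φ : PosDesign) (ξ : Address) (I : Ram) (h : φ.head [] = PosAction.proper ξ I) :
      PosDesign.IsChronicle φ [Action.pos (PosAction.proper ξ I)]
  | cons (φ : PosDesign) (ξ : Address) (I : Ram) (i : ℕ) (J : Ram) (r : List Action)
      (h : φ.head [] = PosAction.proper ξ I) (hi : i ∈ I)
      (hr : PosDesign.IsChronicle (φ.sub i J) r) :
      PosDesign.IsChronicle φ
        (Action.pos (PosAction.proper ξ I) :: Action.neg (ξ ++ [i]) J :: r)

/-- A positive pseudo-design as a set of chronicles. -/
def PosDesign.chronicles (φ : PosDesign) : Set (List Action) := {r | φ.IsChronicle r}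

/-! ### Normalization by the environment machine -/

/-- States `⟨φ | Ψ⟩_q` of the machine. -/
structure State where
  code : PosDesign
  env : Set NegDesign
  index : List Action

/-- `Ψ` accepts `ζ`. -/
def Accepts (Ψ : Set NegDesign) (ζ : Address) : Prop := ∃ ψ ∈ Ψ, ψ.focus = ζ

/-- Rule (R):
`⟨(+,ξ,I)·Ψ' | Ψ⟩_q ⟶ ⟨Ψ_{ξ,I} | Ψ' ∪ (Ψ \ ξ)⟩_q` if `Ψ` accepts `ξ`. -/
inductive StepR : State → State → Prop where
  | mk (φ : PosDesign) (Ψ : Set NegDesign) (q : List Action) (ξ : Address) (I : Ram)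
      (ψ : NegDesign) (h : φ.head [] = PosAction.proper ξ I) (hψ : ψ ∈ Ψ) (hξ : ψ.focus = ξ) :
      StepR ⟨φ, Ψ, q⟩
        ⟨ψ.branch I, {χ | ∃ i ∈ I, χ = φ.child ξ i} ∪ {χ | χ ∈ Ψ ∧ χ.focus ≠ ξ}, q⟩

/-- Rule (S): `⟨(+,ξ,I)·Ψ' | Ψ⟩_q ⟶ ⟨Ψ'_{ξi,J} | Ψ⟩_{q(+,ξ,I)(-,ξi,J)}` if `Ψ` does not
accept `ξ` and `i ∈ I`. -/
inductive StepS : State → State → Prop where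
  | mk (φ : PosDesign) (Ψ : Set NegDesign) (q : List Action) (ξ : Address) (I : Ram)
      (i : ℕ) (J : Ram) (h : φ.head [] = PosAction.proper ξ I) (hΨ : ¬ Accepts Ψ ξ) (hi : i ∈ I) :
      StepS ⟨φ, Ψ, q⟩
        ⟨φ.sub i J, Ψ, q ++ [Action.pos (PosAction.proper ξ I), Action.neg (ξ ++ [i]) J]⟩

/-- The states that can be reached from `⟨φ | Ψ⟩` with the empty index. -/
def Reachable (φ : PosDesign) (Ψ : Set NegDesign) (s : State) : Prop :=
  Relation.ReflTransGen (fun s₁ s₂ => StepR s₁ s₂ ∨ StepS s₁ s₂) ⟨φ, Ψ, []⟩ s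

/-- Non-termination due to rule (R) only. -/
def Diverges (s : State) : Prop :=
  ∃ f : ℕ → State, f 0 = s ∧ ∀ k, StepR (f k) (f (k + 1))

/-- The normal form of `⟨φ | Ψ⟩`, as a set of chronicles. -/
def normalForm (φ : PosDesign) (Ψ : Set NegDesign) : Set (List Action) :=
  {r | ∃ s ξ I, Reachable φ Ψ s ∧ s.code.head [] = PosAction.proper ξ I ∧ ¬ Accepts s.env ξ ∧
      r = s.index ++ [Action.pos (PosAction.proper ξ I)]} ∪
  {r | ∃ s, Reachable φ Ψ s ∧ s.code.head [] = PosAction.omega ∧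
      r = s.index ++ [Action.pos PosAction.omega]} ∪
  {r | ∃ s, Reachable φ Ψ s ∧ s.code.head [] = PosAction.daimon ∧
      r = s.index ++ [Action.pos PosAction.daimon]} ∪
  {r | ∃ s, Reachable φ Ψ s ∧ Diverges s ∧ r = s.index ++ [Action.pos PosAction.omega]}

/-- `φ₀ ⊆ φ`, `ψ₀ ⊆ ψ` and `⟦φ₀,ψ₀⟧` contains all the chronicles of `R`. -/
def Produces (φ : PosDesign) (ψ : NegDesign) (R : Set (List Action))
    (φ₀ : PosDesign) (ψ₀ : NegDesign) : Prop :=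
  φ₀ ⊆ φ ∧ ψ₀ ⊆ ψ ∧ R ⊆ normalForm φ₀ {ψ₀}

/-- `(φ₀,ψ₀)` is the pull-back of the set of chronicles `R` along the normalization of `φ`
against `ψ`: the minimum pair such that `R ⊆ ⟦φ₀,ψ₀⟧`. -/
def IsPullback (φ : PosDesign) (ψ : NegDesign) (R : Set (List Action))
    (φ₀ : PosDesign) (ψ₀ : NegDesign) : Prop :=
  Produces φ ψ R φ₀ ψ₀ ∧ ∀ φ₁ ψ₁, Produces φ ψ R φ₁ ψ₁ → φ₀ ⊆ φ₁ ∧ ψ₀ ⊆ ψ₁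

/-! ### Normalization as a visit: the token machine -/

/-- Occurrences of positive actions in `φ` (`comp = none`) or in `ψ` (`comp = some J` for the
tree `φ_J` of `ψ = {(-,ζ,J) φ_J | J}`). -/
structure Node where
  comp : Option Ram
  path : Path

/-- The node above `n` reached through `(i, J)`. -/
def Node.ext (n : Node) (i : ℕ) (J : Ram) : Node := ⟨n.comp, n.path ++ [(i, J)]⟩

/-- `v.Below n`: `v` is on the branch which leads from the root to `n`. -/
def Node.Below (v n : Node) : Prop := v.comp = n.comp ∧ v.path <+: n.path

/-- The positive action at a node of `φ` or `ψ`. -/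
def actionAt (φ : PosDesign) (ψ : NegDesign) (n : Node) : PosAction :=
  match n.comp with
  | none => φ.head n.path
  | some J => (ψ.branch J).head n.path

/-- An occurrence of an action: that of the positive action at the node `n` (`plus`), or that of
the negative action right below it (`minus`). -/
inductive Sign where
  | plus : Sign
  | minus : Sign

/-- The negative action right below the node `n` is `(-,ζ,J)`. -/
inductive NegActionAt (φ : PosDesign) (ψ : NegDesign) : Node → Address → Ram → Prop where
  | root (J : Ram) : NegActionAt φ ψ ⟨some J, []⟩ ψ.focus J
  | above (n : Node) (ξ : Address) (I : Ram) (i : ℕ) (J : Ram)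
      (h : actionAt φ ψ n = PosAction.proper ξ I) (hi : i ∈ I) :
      NegActionAt φ ψ (n.ext i J) (ξ ++ [i]) J

/-- The positive occurrence at `n`, of focus `ζi`, points to the negative occurrence at `v`, of
focus `ζ`, on the branch below it. -/
def PointsTo (φ : PosDesign) (ψ : NegDesign) (n v : Node) (i : ℕ) : Prop :=
  ∃ (ζ : Address) (I J : Ram), actionAt φ ψ n = PosAction.proper (ζ ++ [i]) I ∧
    v.Below n ∧ NegActionAt φ ψ v ζ J

/-- Configurations of the token machine: the position `(sign, node)` of the token, the set of
bindings `(u, v)` (`u` an occurrence of a positive action and `v` an occurrence of the opposite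
negative action, on the other side), and the chronicle `index` of the normal form under
exploration. -/
structure Token where
  sign : Sign
  node : Node
  bindings : Set (Node × Node)
  index : List Action

/-- The positive occurrence at `n`, whose ramification is `I`, is cut against the negative
occurrence at `m`: either `n` is the occurrence in `φ` of a free action whose focus is the
address of the cut, and `m` is the corresponding initial occurrence of `ψ`; or `n` points to `v`
and `v` is bound to `u`, and then `m` is the occurrence `u i I`. -/
inductive CutAgainst (φ : PosDesign) (ψ : NegDesign) (B : Set (Node × Node)) (I : Ram) :
    Node → Node → Prop where
  | root (p : Path) : φ.head p = PosAction.proper ψ.focus I →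
      CutAgainst φ ψ B I ⟨none, p⟩ ⟨some I, []⟩
  | bound (n u v : Node) (i : ℕ) : PointsTo φ ψ n v i → (u, v) ∈ B →
      CutAgainst φ ψ B I n (u.ext i I)

/-- The moves of the token. From a negative occurrence it moves to the positive occurrence right
above it. From a positive occurrence it moves to the negative occurrence against which it is cut.
If there is none, then the action belongs to the normal form, and the opponent chooses the branch
of the normal form to be explored. -/
inductive TokenStep (φ : PosDesign) (ψ : NegDesign) : Token → Token → Prop where
  | up (n : Node) (B : Set (Node × Node)) (q : List Action) :
      TokenStep φ ψ ⟨Sign.minus, n, B, q⟩ ⟨Sign.plus, n, B, q⟩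
  | cut (n m : Node) (B : Set (Node × Node)) (q : List Action) (ξ : Address) (I : Ram)
      (h : actionAt φ ψ n = PosAction.proper ξ I) (hm : CutAgainst φ ψ B I n m) :
      TokenStep φ ψ ⟨Sign.plus, n, B, q⟩ ⟨Sign.minus, m, insert (n, m) B, q⟩
  | free (n : Node) (B : Set (Node × Node)) (q : List Action) (ξ : Address) (I : Ram)
      (i : ℕ) (J : Ram) (h : actionAt φ ψ n = PosAction.proper ξ I)
      (hn : ∀ m, ¬ CutAgainst φ ψ B I n m) (hi : i ∈ I) :
      TokenStep φ ψ ⟨Sign.plus, n, B, q⟩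
        ⟨Sign.minus, n.ext i J, B,
          q ++ [Action.pos (PosAction.proper ξ I), Action.neg (ξ ++ [i]) J]⟩

/-- `TokenReach φ ψ k t`: the configuration `t` can be reached in `k` moves when the token is
initially placed at the root of `φ`. -/
inductive TokenReach (φ : PosDesign) (ψ : NegDesign) : ℕ → Token → Prop where
  | start : TokenReach φ ψ 0 ⟨Sign.plus, ⟨none, []⟩, ∅, []⟩
  | step (k : ℕ) (t t' : Token) (h : TokenReach φ ψ k t) (hs : TokenStep φ ψ t t') :
      TokenReach φ ψ (k + 1) t'

/-- During the normalization of `φ` against `ψ` which explores the chronicles of `R`, the token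
visits the occurrence `(σ, n)` at time `k`, in the configuration `t`. -/
def VisitAt (φ : PosDesign) (ψ : NegDesign) (R : Set (List Action)) (σ : Sign) (n : Node)
    (k : ℕ) (t : Token) : Prop :=
  TokenReach φ ψ k t ∧ (∃ r ∈ R, t.index <+: r) ∧ t.sign = σ ∧ t.node = n

/-- `(σ, n)` is an occurrence of an action in `φ` or `ψ` (as sets of chronicles, that is, not
counting `Ω` nor the negative actions followed by `Ω`). -/
def IsOccurrence (φ : PosDesign) (ψ : NegDesign) (σ : Sign) (n : Node) : Prop :=
  actionAt φ ψ n ≠ PosAction.omega ∧ (σ = Sign.minus → n ≠ ⟨none, []⟩)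

/-- Each node of `φ₀` and `ψ₀` is visited exactly once during the normalization of `φ` against
`ψ` which explores the chronicles of `R`. -/
def VisitedOnce (φ : PosDesign) (ψ : NegDesign) (R : Set (List Action))
    (φ₀ : PosDesign) (ψ₀ : NegDesign) : Prop :=
  ∀ σ n, IsOccurrence φ₀ ψ₀ σ n → ∃! x : ℕ × Token, VisitAt φ ψ R σ n x.1 x.2

end Ludics

namespace Ludics

/-! The reason is linearity. Typing splits contexts disjointly among subdesigns, so throughout
normalization an address belongs to the context of the code or of one element of the environment,
never to two of them. A negative subdesign, once called, is therefore gone for good; and after a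
free action, runs through different children call disjoint parts of the environment.

To compare runs, normalization is replayed on positions of the fixed `φ` and `ψ`: a configuration
`Cfg` consists of a current node, the negative subdesigns (cells) in the environment, and a history.
`Cfg.Inv` collects its invariants. The central fact is `Cfg.eq_of_cell_eq`: two configurations of
the exploration above the same cell are equal. If one run extends the other, a second entry
contradicts `Cfg.Inv.step_fresh`. If they split, they split at a free action; the same child with
two ramifications is excluded by `DetRam`, and different children by `Cfg.Inv.fork`.

Both machines of the statement are read off configurations: states by `Cfg.toState`, tokens by
`Cfg.Inv.cutAgainst_iff`, which says that pointers and bindings find the same opponent as addresses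
do.

Finally, cutting `φ` and `ψ` down to their visited nodes does not alter the runs
(`exists_produces_visited`), so by minimality the pull-back has visited nodes only. Equality of
configurations above a cell then gives both the uniqueness of visits and the uniqueness of
ramifications, that is, slices. -/

/-! ### Typing derivations and their contexts -/

theorem NegTypingRule.mono {R R' : PosDesign → Finset Address → Prop}
    (h : ∀ φ Γ, R φ Γ → R' φ Γ) {ψ : NegDesign} {ζ : Address} {Λ : Finset Address}
    (hψ : NegTypingRule R ψ ζ Λ) : NegTypingRule R' ψ ζ Λ := by
  obtain ⟨h₁, h₂, h₃, h₄⟩ := hψ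
  refine ⟨h₁, h₂, h₃, fun J => ?_⟩
  obtain ⟨ΛJ, hs, hR⟩ := h₄ J
  exact ⟨ΛJ, hs, h _ _ hR⟩

theorem PosTypingRule.mono {R R' : PosDesign → Finset Address → Prop}
    (h : ∀ φ Γ, R φ Γ → R' φ Γ) {φ : PosDesign} {Γ : Finset Address}
    (hφ : PosTypingRule R φ Γ) : PosTypingRule R' φ Γ := by
  refine ⟨hφ.1, fun ξ I hh => ?_⟩
  obtain ⟨hξ, Λ, h₁, h₂, h₃⟩ := hφ.2 ξ I hh
  exact ⟨hξ, Λ, h₁, h₂, fun i hi => (h₃ i hi).mono h⟩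

theorem PosTyped.rule {φ : PosDesign} {Γ : Finset Address} (h : PosTyped φ Γ) :
    PosTypingRule PosTyped φ Γ := by
  obtain ⟨R, hR, hφ⟩ := h
  exact (hR _ _ hφ).mono fun φ' Γ' h' => ⟨R, hR, h'⟩

/-- Typing is preserved when subtrees are replaced by `Ω`. -/
theorem PosTyped.of_subset {φ₀ φ : PosDesign} {Γ : Finset Address} (hs : φ₀ ⊆ φ)
    (h : PosTyped φ Γ) : PosTyped φ₀ Γ := by
  -- Coinduction: being below a typed design is closed backwards under the rules, since a proper
  -- root is shared with the larger design.
  refine ⟨fun φ' Γ' => ∃ φ'', φ' ⊆ φ'' ∧ PosTyped φ'' Γ', ?_, φ, hs, h⟩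
  rintro φ' Γ' ⟨φ'', hs, h⟩
  have hr := h.rule
  refine ⟨hr.1, fun ξ I hh => ?_⟩
  have hh' : φ''.head [] = PosAction.proper ξ I := by
    rcases hs [] with h0 | h0
    · rw [hh] at h0; cases h0
    · rw [← h0, hh]
  obtain ⟨hξ, Λ, h₁, h₂, h₃⟩ := hr.2 ξ I hh'
  refine ⟨hξ, Λ, h₁, h₂, fun i hi => ?_⟩
  obtain ⟨g₁, g₂, g₃, g₄⟩ := h₃ i hi
  refine ⟨rfl, g₂, g₃, fun J => ?_⟩
  obtain ⟨ΛJ, hJ, hR⟩ := g₄ J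
  exact ⟨ΛJ, hJ, φ''.sub i J, fun p => hs ((i, J) :: p), hR⟩

theorem NegTyped.of_subset {ψ₀ ψ : NegDesign} {ζ : Address} {Λ : Finset Address} (hs : ψ₀ ⊆ ψ)
    (h : NegTyped ψ ζ Λ) : NegTyped ψ₀ ζ Λ := by
  obtain ⟨h₁, h₂, h₃, h₄⟩ := h
  refine ⟨hs.1.trans h₁, h₂, h₃, fun J => ?_⟩
  obtain ⟨ΛJ, hJ, hR⟩ := h₄ J
  exact ⟨ΛJ, hJ, hR.of_subset (hs.2 J)⟩

/-- A typing derivation of a positive design assigns a context `G p` to each node and a context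
`L p i` to each negative subdesign above it. -/
theorem PosTyped.exists_contexts {φ : PosDesign} {Γ : Finset Address} (hφ : PosTyped φ Γ) :
    ∃ (G : Path → Finset Address) (L : Path → ℕ → Finset Address), G [] = Γ ∧
      ∀ p a I, φ.head p = PosAction.proper a I →
        WellFormed (G p) ∧ a ∈ G p ∧ (∀ i ∈ I, L p i ⊆ (G p).erase a) ∧
        (∀ i ∈ I, ∀ j ∈ I, i ≠ j → Disjoint (L p i) (L p j)) ∧
        ∀ i ∈ I, ∀ J, G (p ++ [(i, J)]) ⊆ locusStar (a ++ [i]) J ∪ L p i := by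
  -- One step of the derivation, made total (empty contexts when there is nothing to type) so that
  -- choice can be iterated along a path.
  have key : ∀ (φ : PosDesign) (Γ : Finset Address), ∃ (lam : ℕ → Finset Address)
      (next : ℕ → Ram → Finset Address), PosTyped φ Γ →
        ∀ a I, φ.head [] = PosAction.proper a I →
        WellFormed Γ ∧ a ∈ Γ ∧ (∀ i ∈ I, lam i ⊆ Γ.erase a) ∧
        (∀ i ∈ I, ∀ j ∈ I, i ≠ j → Disjoint (lam i) (lam j)) ∧
        ∀ i ∈ I, ∀ J, next i J ⊆ locusStar (a ++ [i]) J ∪ lam i ∧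
          PosTyped (φ.sub i J) (next i J) := by
    intro φ Γ
    by_cases h : PosTyped φ Γ ∧ ∃ a I, φ.head [] = PosAction.proper a I
    · obtain ⟨ht, a, I, hh⟩ := h
      obtain ⟨hwf, hr⟩ := ht.rule
      obtain ⟨ha, Λ, h₁, h₂, h₃⟩ := hr a I hh
      have h₄ : ∀ (i : ℕ) (J : Ram), ∃ Δ : Finset Address, i ∈ I →
          Δ ⊆ locusStar (a ++ [i]) J ∪ Λ i ∧ PosTyped (φ.sub i J) Δ := by
        intro i J
        by_cases hi : i ∈ I
        · obtain ⟨ΛJ, hs, hR⟩ := (h₃ i hi).2.2.2 J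
          exact ⟨_, fun _ => ⟨Finset.union_subset_union_right hs, hR⟩⟩
        · exact ⟨∅, fun h => absurd h hi⟩
      choose next hnext using h₄
      refine ⟨Λ, next, fun _ a' I' hh' => ?_⟩
      rw [hh] at hh'
      cases hh'
      exact ⟨hwf, ha, h₁, h₂, fun i hi J => hnext i J hi⟩
    · exact ⟨fun _ => ∅, fun _ _ => ∅, fun ht a I hh => absurd ⟨ht, a, I, hh⟩ h⟩
  choose lam next hkey using key
  let W : Path → PosDesign × Finset Address := fun p =>
    p.foldl (fun x y => (x.1.sub y.1 y.2, next x.1 x.2 y.1 y.2)) (φ, Γ)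
  have hW : ∀ p i J, W (p ++ [(i, J)]) = ((W p).1.sub i J, next (W p).1 (W p).2 i J) := by
    intro p i J
    simp [W]
  have hhead : ∀ p q, (W p).1.head q = φ.head (p ++ q) := by
    intro p
    induction p using List.reverseRecOn with
    | nil => intro q; rfl
    | append_singleton p x ih =>
      intro q
      obtain ⟨i, J⟩ := x
      rw [hW]
      change (W p).1.head ((i, J) :: q) = _
      rw [ih]
      simp
  have hhead0 : ∀ p, (W p).1.head [] = φ.head p := fun p => by simpa using hhead p []
  -- Restricted to nodes other than `Ω`: only there does `tree` ensure that the path stays inside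
  -- the ramifications, outside of which typing says nothing.
  have htyped : ∀ p, φ.head p ≠ PosAction.omega → PosTyped (W p).1 (W p).2 := by
    intro p
    induction p using List.reverseRecOn with
    | nil => intro _; exact hφ
    | append_singleton p x ih =>
      intro hp
      obtain ⟨i, J⟩ := x
      obtain ⟨a, I, hh, hi⟩ := φ.tree p i J hp
      have := ih (by rw [hh]; simp)
      rw [hW]
      exact ((hkey _ _ this a I ((hhead0 p).trans hh)).2.2.2.2 i hi J).2
  refine ⟨fun p => (W p).2, fun p i => lam (W p).1 (W p).2 i, rfl, fun p a I hh => ?_⟩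
  obtain ⟨h₁, h₂, h₃, h₄, h₅⟩ := hkey _ _ (htyped p (by rw [hh]; simp)) a I ((hhead0 p).trans hh)
  refine ⟨h₁, h₂, h₃, h₄, fun i hi J => ?_⟩
  have := (h₅ i hi J).1
  simpa [hW] using this

/-! ### Positions in the two designs -/

/-- The negative subdesigns of `φ` and `ψ`: `root` is `ψ` itself, `pos n i` is the negative
subdesign number `i` above the node `n`; `start` stands below the root of `φ`. -/
inductive Cell where
  | start : Cell
  | root : Cell
  | pos (n : Node) (i : ℕ) : Cell

/-- The node above the negative action of ramification `J` of a cell. -/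
def Cell.node : Cell → Ram → Node
  | start, _ => ⟨none, []⟩
  | root, J => ⟨some J, []⟩
  | pos n i, J => n.ext i J

/-- The cell to which a node belongs. -/
def Node.cell (n : Node) : Cell :=
  match n.path.getLast? with
  | none => (match n.comp with | none => Cell.start | some _ => Cell.root)
  | some x => Cell.pos ⟨n.comp, n.path.dropLast⟩ x.1

@[simp] theorem Node.cell_ext (n : Node) (i : ℕ) (J : Ram) : (n.ext i J).cell = Cell.pos n i := by
  simp [Node.cell, Node.ext]

@[simp] theorem Cell.cell_node (e : Cell) (J : Ram) : (e.node J).cell = e := by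
  cases e <;> simp [Cell.node]
  · rfl
  · rfl

/-- The focus of a negative subdesign. -/
def Cell.focus (φ : PosDesign) (ψ : NegDesign) : Cell → Address
  -- Default values, here and for improper actions: the invariants keep such cells out of the
  -- environment.
  | start => []
  | root => ψ.focus
  | pos n i => match actionAt φ ψ n with
    | PosAction.proper a _ => a ++ [i]
    | _ => []

theorem Cell.focus_pos {φ : PosDesign} {ψ : NegDesign} {n : Node} {a : Address} {I : Ram}
    (h : actionAt φ ψ n = PosAction.proper a I) (i : ℕ) :
    (Cell.pos n i).focus φ ψ = a ++ [i] := by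
  simp [Cell.focus, h]

theorem actionAt_tree {φ : PosDesign} {ψ : NegDesign} {n : Node} {i : ℕ} {J : Ram}
    (h : actionAt φ ψ (n.ext i J) ≠ PosAction.omega) :
    ∃ a I, actionAt φ ψ n = PosAction.proper a I ∧ i ∈ I := by
  obtain ⟨c, p⟩ := n
  cases c with
  | none => exact φ.tree p i J h
  | some K => exact (ψ.branch K).tree p i J h

theorem mem_locusStar {a b : Address} {J : Ram} :
    b ∈ locusStar a J ↔ ∃ j ∈ J, b = a ++ [j] := by
  simp [locusStar, eq_comm]

/-- Contexts for all the subdesigns of `φ` and `ψ`, as given by a typing derivation. -/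
structure Contexts (φ : PosDesign) (ψ : NegDesign) (G : Node → Finset Address)
    (L : Cell → Finset Address) : Prop where
  wf : ∀ {n a I}, actionAt φ ψ n = PosAction.proper a I → WellFormed (G n)
  mem : ∀ {n a I}, actionAt φ ψ n = PosAction.proper a I → a ∈ G n
  sub : ∀ {n a I}, actionAt φ ψ n = PosAction.proper a I → ∀ {i}, i ∈ I →
    L (Cell.pos n i) ⊆ (G n).erase a
  disj : ∀ {n a I}, actionAt φ ψ n = PosAction.proper a I → ∀ {i j}, i ∈ I → j ∈ I → i ≠ j →
    Disjoint (L (Cell.pos n i)) (L (Cell.pos n j))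
  above : ∀ {n a I}, actionAt φ ψ n = PosAction.proper a I → ∀ {i}, i ∈ I → ∀ J,
    G (n.ext i J) ⊆ locusStar (a ++ [i]) J ∪ L (Cell.pos n i)
  root : ∀ J, G ⟨some J, []⟩ ⊆ locusStar ψ.focus J ∪ L Cell.root
  root_wf : ∀ b ∈ L Cell.root, ¬ b <+: ψ.focus

theorem exists_contexts {φ : PosDesign} {ψ : NegDesign} {Γ Λ : Finset Address} {ξ : Address}
    (hφ : PosTyped φ Γ) (hψ : NegTyped ψ ξ Λ) :
    ∃ G L, Contexts φ ψ G L ∧ G ⟨none, []⟩ = Γ ∧ L Cell.root = Λ := by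
  obtain ⟨G₁, L₁, h₁, H₁⟩ := hφ.exists_contexts
  obtain ⟨hf, hξ, hwf, hJ⟩ := hψ
  subst hf
  choose Δ hΔ hΔt using hJ
  choose G₂ L₂ h₂ H₂ using fun J => (hΔt J).exists_contexts
  refine ⟨fun n => match n.comp with | none => G₁ n.path | some J => G₂ J n.path,
    fun e => match e with
      | Cell.start => ∅
      | Cell.root => Λ
      | Cell.pos n i => match n.comp with | none => L₁ n.path i | some J => L₂ J n.path i,
    ⟨?_, ?_, ?_, ?_, ?_, ?_, ?_⟩, h₁, rfl⟩
  · rintro ⟨_ | J, p⟩ a I h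
    exacts [(H₁ p a I h).1, (H₂ J p a I h).1]
  · rintro ⟨_ | J, p⟩ a I h
    exacts [(H₁ p a I h).2.1, (H₂ J p a I h).2.1]
  · rintro ⟨_ | J, p⟩ a I h i hi
    exacts [(H₁ p a I h).2.2.1 i hi, (H₂ J p a I h).2.2.1 i hi]
  · rintro ⟨_ | J, p⟩ a I h i j hi hj hij
    exacts [(H₁ p a I h).2.2.2.1 i hi j hj hij, (H₂ J p a I h).2.2.2.1 i hi j hj hij]
  · rintro ⟨_ | J, p⟩ a I h i hi K
    exacts [(H₁ p a I h).2.2.2.2 i hi K, (H₂ J p a I h).2.2.2.2 i hi K]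
  · intro J
    change G₂ J [] ⊆ _
    rw [h₂]
    exact Finset.union_subset_union_right (hΔ J)
  · intro b hb hp
    have := hwf b (Finset.mem_insert_of_mem hb) _ (Finset.mem_insert_self _ _) hp
    exact hξ (this ▸ hb)

section
variable {φ : PosDesign} {ψ : NegDesign} {G : Node → Finset Address} {L : Cell → Finset Address}

theorem NegActionAt.unique {v : Node} {ζ ζ' : Address} {J J' : Ram}
    (h : NegActionAt φ ψ v ζ J) (h' : NegActionAt φ ψ v ζ' J') : ζ = ζ' := by
  cases h with
  | root =>
    generalize hv : (⟨some J, []⟩ : Node) = v at h'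
    cases h' with
    | root => rfl
    | above n => simp [Node.ext] at hv
  | above n a I i J h hi =>
    generalize hv : n.ext i J = v at h'
    cases h' with
    | root => simp [Node.ext] at hv
    | above n' a' I' i' J' h' hi' =>
      have : n = n' ∧ i = i' := by simpa using congrArg Node.cell hv
      obtain ⟨rfl, rfl⟩ := this
      rw [h] at h'
      cases h'
      rfl

/-- Below a node, the opponent's foci are not extensions of the addresses of the context. -/
theorem Contexts.not_prefix (H : Contexts φ ψ G L) {n : Node}
    (hn : actionAt φ ψ n ≠ PosAction.omega) {v : Node} (hv : v.Below n) {ζ : Address} {J : Ram}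
    (hζ : NegActionAt φ ψ v ζ J) {b : Address} (hb : b ∈ G n) : ¬ b <+: ζ := by
  obtain ⟨c, p⟩ := n
  induction p using List.reverseRecOn generalizing b with
  | nil =>
    obtain ⟨vc, vp⟩ := v
    obtain ⟨rfl, h2⟩ := hv
    obtain rfl : vp = [] := by simpa using h2
    generalize hw : (⟨vc, []⟩ : Node) = v at hζ
    cases hζ with
    | root =>
      simp only [Node.mk.injEq] at hw
      rw [hw.1] at hb
      intro hp
      rcases Finset.mem_union.1 (H.root J hb) with h | h
      · obtain ⟨j, -, rfl⟩ := mem_locusStar.1 h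
        simpa using hp.length_le
      · exact H.root_wf b h hp
    | above n => simp [Node.ext] at hw
  | append_singleton p x ih =>
    obtain ⟨i, K⟩ := x
    obtain ⟨a, I, ha, hi⟩ := actionAt_tree (n := ⟨c, p⟩) hn
    have hsub := H.sub ha hi
    rcases List.prefix_concat_iff.1 hv.2 with h | h
    · obtain rfl : v = Node.ext ⟨c, p⟩ i K := by
        obtain ⟨vc, vp⟩ := v
        simp only [Node.ext, Node.mk.injEq]
        exact ⟨hv.1, h⟩
      obtain rfl := hζ.unique (NegActionAt.above _ a I i K ha hi)
      intro hp
      rcases Finset.mem_union.1 (H.above ha hi K hb) with h | h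
      · obtain ⟨j, -, rfl⟩ := mem_locusStar.1 h
        simpa using hp.length_le
      · have hb' := Finset.mem_erase.1 (hsub h)
        rcases List.prefix_concat_iff.1 hp with h' | h'
        · exact hb'.1 (H.wf ha a (H.mem ha) b hb'.2 (h' ▸ List.prefix_append _ _)).symm
        · exact hb'.1 (H.wf ha b hb'.2 a (H.mem ha) h')
    -- For a focus further down, a new address extends `a`, which the induction hypothesis already
    -- covers; the others are inherited.
    · have ih' := fun b => ih (b := b) (by rw [ha]; simp) ⟨hv.1, h⟩
      rcases Finset.mem_union.1 (H.above (n := ⟨c, p⟩) ha hi K hb) with h | h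
      · obtain ⟨j, -, rfl⟩ := mem_locusStar.1 h
        intro hp
        refine ih' a (H.mem ha) (List.IsPrefix.trans ?_ hp)
        simp
      · exact ih' b (Finset.mem_of_mem_erase (hsub h))

/-- On a branch, the negative actions have distinct foci. -/
theorem Contexts.below_unique (H : Contexts φ ψ G L) {n v v' : Node} (hv : v.Below n)
    (hv' : v'.Below n) {ζ : Address} {J J' : Ram} (h : NegActionAt φ ψ v ζ J)
    (h' : NegActionAt φ ψ v' ζ J') : v = v' := by
  have key : ∀ {v v' : Node} {J J' : Ram}, v.Below v' → NegActionAt φ ψ v ζ J →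
      NegActionAt φ ψ v' ζ J' → v = v' := by
    intro v v' J J' hb h h'
    obtain ⟨c, p⟩ := v
    cases h' with
    | root =>
      obtain ⟨h1, h2⟩ := hb
      simp only [Node.mk.injEq]
      exact ⟨h1, by simpa using h2⟩
    | above m a I i K ha hi =>
      rcases List.prefix_concat_iff.1 hb.2 with h2 | h2
      · simp only [Node.ext, Node.mk.injEq]
        exact ⟨hb.1, h2⟩
      · refine absurd ?_ (H.not_prefix (n := m) (by rw [ha]; simp) ⟨hb.1, h2⟩ h (H.mem ha))
        simp
  rcases List.prefix_or_prefix_of_prefix hv.2 hv'.2 with h2 | h2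
  · exact key ⟨hv.1.trans hv'.1.symm, h2⟩ h h'
  · exact (key ⟨hv'.1.trans hv.1.symm, h2⟩ h' h).symm

end

/-! ### Configurations and invariants -/

/-- Configurations of the environment machine, seen as a machine which moves on the occurrences of
actions of `φ` and `ψ`: the code is the tree above `node`, the environment consists of the
subdesigns in `cells`. The other fields record the history of the run. -/
structure Cfg where
  node : Node
  cells : Set Cell
  fired : Set Node
  used : Set Cell
  bindings : Set (Node × Node)
  index : List Action
  time : ℕ

/-- The initial configuration. -/
def Cfg.init : Cfg := ⟨⟨none, []⟩, {Cell.root}, ∅, {Cell.start}, ∅, [], 0⟩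

/-- `fired` collects the nodes whose positive action has been played, `used` the cells that have
been entered. A free step keeps the whole environment, without splitting it, and enters a child that
never was in the environment. -/
inductive Cfg.Step (φ : PosDesign) (ψ : NegDesign) : Cfg → Cfg → Prop where
  | cut (s : Cfg) (a : Address) (I : Ram) (e : Cell)
      (h : actionAt φ ψ s.node = PosAction.proper a I) (he : e ∈ s.cells)
      (hf : e.focus φ ψ = a) :
      Cfg.Step φ ψ s
        ⟨e.node I, {x | ∃ i ∈ I, x = Cell.pos s.node i} ∪ {x | x ∈ s.cells ∧ x.focus φ ψ ≠ a},
          insert s.node s.fired, insert e s.used, insert (s.node, e.node I) s.bindings, s.index,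
          s.time + 1⟩
  | free (s : Cfg) (a : Address) (I : Ram) (i : ℕ) (J : Ram)
      (h : actionAt φ ψ s.node = PosAction.proper a I)
      (hn : ∀ e ∈ s.cells, e.focus φ ψ ≠ a) (hi : i ∈ I) :
      Cfg.Step φ ψ s
        ⟨s.node.ext i J, s.cells, insert s.node s.fired, insert (Cell.pos s.node i) s.used,
          s.bindings, s.index ++ [Action.pos (PosAction.proper a I), Action.neg (a ++ [i]) J],
          s.time + 1⟩

abbrev Cfg.Steps (φ : PosDesign) (ψ : NegDesign) : Cfg → Cfg → Prop :=
  Relation.ReflTransGen (Cfg.Step φ ψ)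

/-- The positive occurrence at a node of focus `e.focus` points to an occurrence which is bound
to the positive action right below `e`. -/
def Link (φ : PosDesign) (ψ : NegDesign) (B : Set (Node × Node)) (o : Node) : Cell → Prop
  | Cell.start => False
  | Cell.root => o.comp = none
  | Cell.pos u i => ∃ v ζ J, v.Below o ∧ NegActionAt φ ψ v ζ J ∧
      (Cell.pos u i).focus φ ψ = ζ ++ [i] ∧ (u, v) ∈ B

theorem Link.mono {φ : PosDesign} {ψ : NegDesign} {B B' : Set (Node × Node)} {o o' : Node}
    {e : Cell} (h : Link φ ψ B o e) (hB : B ⊆ B') (ho : o.Below o') : Link φ ψ B' o' e := by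
  cases e with
  | start => exact h
  | root => exact ho.1.symm.trans h
  | pos u i =>
    obtain ⟨v, ζ, J, h₁, h₂, h₃, h₄⟩ := h
    exact ⟨v, ζ, J, ⟨h₁.1.trans ho.1, h₁.2.trans ho.2⟩, h₂, h₃, hB h₄⟩

theorem Node.Below.refl (n : Node) : n.Below n := ⟨rfl, List.prefix_rfl⟩

theorem Node.below_ext (n : Node) (i : ℕ) (J : Ram) : n.Below (n.ext i J) :=
  ⟨rfl, List.prefix_append _ _⟩

/-- The addresses in the contexts of the code and of the environment. -/
def Cfg.names (G : Node → Finset Address) (L : Cell → Finset Address) (s : Cfg) : Set Address :=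
  {a | a ∈ G s.node ∨ ∃ e ∈ s.cells, a ∈ L e}

/-- The invariants of the machine. -/
structure Cfg.Inv (φ : PosDesign) (ψ : NegDesign) (G : Node → Finset Address)
    (L : Cell → Finset Address) (s : Cfg) : Prop where
  focus_inj : ∀ e ∈ s.cells, ∀ e' ∈ s.cells, e.focus φ ψ <+: e'.focus φ ψ → e = e'
  -- Linearity: each address has a single owner, the code or one cell.
  code_disj : ∀ e ∈ s.cells, ∀ a ∈ G s.node, a ∉ L e
  env_disj : ∀ e ∈ s.cells, ∀ e' ∈ s.cells, ∀ a, a ∈ L e → a ∈ L e' → e = e'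
  names_wf : ∀ a ∈ s.names G L, ∀ b ∈ s.names G L, a <+: b → a = b
  -- An address comparable with that of the cut always finds its opponent, so a focus which is not
  -- accepted is foreign to the cut.
  accepted : ∀ a ∈ s.names G L, (a <+: ψ.focus ∨ ψ.focus <+: a) →
    ∃ e ∈ s.cells, e.focus φ ψ = a
  focus_ext : ∀ e ∈ s.cells, ψ.focus <+: e.focus φ ψ
  cells_pos : ∀ n i, Cell.pos n i ∈ s.cells → n ∈ s.fired ∧
    ∃ a I, actionAt φ ψ n = PosAction.proper a I ∧ i ∈ I ∧ ψ.focus <+: a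
  cells_used : ∀ e ∈ s.cells, e ∉ s.used
  start_used : Cell.start ∈ s.used
  used_pos : ∀ n i, Cell.pos n i ∈ s.used → n ∈ s.fired
  fired_used : ∀ n ∈ s.fired, n.cell ∈ s.used
  node_fired : s.node ∉ s.fired
  node_used : s.node.cell ∈ s.used
  -- Required for all the addresses of the contexts, not only for the focus about to be played,
  -- because a call may take place much higher in the tree.
  link_code : ∀ a ∈ G s.node, ∀ e ∈ s.cells, e.focus φ ψ = a → Link φ ψ s.bindings s.node e
  link_env : ∀ e' ∈ s.cells, ∀ a ∈ L e', ∀ e ∈ s.cells, e.focus φ ψ = a →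
    ∀ J, Link φ ψ s.bindings (e'.node J) e
  bound_used : ∀ u v, (u, v) ∈ s.bindings → v.cell ∈ s.used
  bound_unique : ∀ u u' v, (u, v) ∈ s.bindings → (u', v) ∈ s.bindings → u = u'
  bound_focus : ∀ u v, (u, v) ∈ s.bindings → ∀ ζ J, NegActionAt φ ψ v ζ J → ψ.focus <+: ζ

/-! ### Preservation of the invariants -/

section
variable {φ : PosDesign} {ψ : NegDesign} {G : Node → Finset Address} {L : Cell → Finset Address}

theorem Contexts.node (H : Contexts φ ψ G L) {s : Cfg} (hs : s.Inv φ ψ G L) {e : Cell}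
    (he : e ∈ s.cells) (I : Ram) {b : Address} (hb : b ∈ G (e.node I)) :
    (∃ j ∈ I, b = e.focus φ ψ ++ [j]) ∨ b ∈ L e := by
  cases e with
  | start => exact absurd hs.start_used (hs.cells_used _ he)
  | root => simpa [mem_locusStar, Cell.focus, Cell.node] using H.root I hb
  | pos n i =>
    obtain ⟨-, a, I', ha, hi, -⟩ := hs.cells_pos n i he
    have := H.above ha hi I hb
    rw [Cell.focus_pos ha]
    simpa [mem_locusStar] using this

theorem negActionAt_node {s : Cfg} (hs : s.Inv φ ψ G L) {e : Cell}
    (he : e ∈ s.cells) (I : Ram) : NegActionAt φ ψ (e.node I) (e.focus φ ψ) I := by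
  cases e with
  | start => exact absurd hs.start_used (hs.cells_used _ he)
  | root => exact NegActionAt.root I
  | pos n i =>
    obtain ⟨-, a, I', ha, hi, -⟩ := hs.cells_pos n i he
    rw [Cell.focus_pos ha]
    exact NegActionAt.above _ _ _ _ _ ha hi

/-- Extensions of `a` by words of equal length are mutually incomparable, and inherit from `a` its
incomparability with the rest. A cut lengthens by 1, a free step followed by a negative action by 2.
-/
theorem prefix_antichain_extend {U : Set Address} (hU : ∀ a ∈ U, ∀ b ∈ U, a <+: b → a = b)
    {a : Address} (ha : a ∈ U) {d : ℕ} {U' : Set Address}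
    (h : ∀ x ∈ U', (x ∈ U ∧ x ≠ a) ∨ ∃ w : Address, w.length = d ∧ x = a ++ w) :
    ∀ x ∈ U', ∀ y ∈ U', x <+: y → x = y := by
  intro x hx y hy hp
  rcases h x hx with ⟨hxU, hxa⟩ | ⟨w, hw, rfl⟩ <;> rcases h y hy with ⟨hyU, hya⟩ | ⟨w', hw', rfl⟩
  · exact hU x hxU y hyU hp
  · exfalso
    rcases List.prefix_or_prefix_of_prefix hp (List.prefix_append a w') with h' | h'
    · exact hxa (hU x hxU a ha h')
    · exact hxa (hU a ha x hxU h').symm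
  · exact absurd (hU a ha y hyU ((List.prefix_append a w).trans hp)).symm hya
  · exact hp.eq_of_length (by simp [hw, hw'])

theorem Cfg.inv_init (H : Contexts φ ψ G L) {Λ₁ Λ₂ : Finset Address}
    (hG : G ⟨none, []⟩ = insert ψ.focus Λ₁) (hL : L Cell.root = Λ₂) (hΛ : Disjoint Λ₁ Λ₂)
    (hwf : WellFormed (insert ψ.focus (Λ₁ ∪ Λ₂))) : Cfg.init.Inv φ ψ G L := by
  have hroot : ∀ b ∈ Λ₂, ¬ b <+: ψ.focus := by
    intro b hb
    exact H.root_wf b (hL ▸ hb)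
  have hmem : ∀ a ∈ Cfg.init.names G L, a ∈ insert ψ.focus (Λ₁ ∪ Λ₂) := by
    rintro a (h | ⟨e, he, h⟩)
    · change a ∈ G ⟨none, []⟩ at h
      rw [hG] at h
      simp only [Finset.mem_insert, Finset.mem_union] at h ⊢
      tauto
    · obtain rfl : e = Cell.root := he
      rw [hL] at h
      simp [h]
  constructor
  · rintro e he e' he' -
    exact Eq.trans (b := Cell.root) he he'.symm
  · rintro e he a ha
    obtain rfl : e = Cell.root := he
    change a ∈ G ⟨none, []⟩ at ha
    rw [hG] at ha
    rw [hL]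
    rcases Finset.mem_insert.1 ha with rfl | ha
    · exact fun h => hroot _ h List.prefix_rfl
    · exact Finset.disjoint_left.1 hΛ ha
  · rintro e he e' he' - - -
    exact Eq.trans (b := Cell.root) he he'.symm
  · exact fun a ha b hb => hwf a (hmem a ha) b (hmem b hb)
  · intro a ha h
    refine ⟨Cell.root, rfl, ?_⟩
    change ψ.focus = a
    rcases h with h | h
    · exact (hwf a (hmem a ha) _ (Finset.mem_insert_self _ _) h).symm
    · exact hwf _ (Finset.mem_insert_self _ _) a (hmem a ha) h
  · rintro e he
    obtain rfl : e = Cell.root := he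
    exact List.prefix_rfl
  · rintro n i ⟨⟩
  · rintro e he
    obtain rfl : e = Cell.root := he
    rintro ⟨⟩
  · rfl
  · rintro n i ⟨⟩
  · rintro n ⟨⟩
  · rintro ⟨⟩
  · rfl
  · rintro a - e he -
    obtain rfl : e = Cell.root := he
    rfl
  · rintro e' he' a ha e he hf
    obtain rfl : e = Cell.root := he
    obtain rfl : e' = Cell.root := he'
    rw [hL] at ha
    exact absurd (hf ▸ List.prefix_rfl) (hroot a ha)
  · rintro u v ⟨⟩
  · rintro u u' v ⟨⟩
  · rintro u v ⟨⟩

/-- Ownership is only redistributed: the addresses claimed by the children come from the code, and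
the called cell hands its context to the new code. The only new addresses are the `a j` with `j ∈
I`, and they are exactly the foci of the cells just added, both ramifications being `I`. -/
theorem Cfg.Inv.cut (H : Contexts φ ψ G L) {s : Cfg} (hs : s.Inv φ ψ G L) {a : Address} {I : Ram}
    {e : Cell} (h : actionAt φ ψ s.node = PosAction.proper a I) (he : e ∈ s.cells)
    (hf : e.focus φ ψ = a) :
    Cfg.Inv φ ψ G L ⟨e.node I,
      {x | ∃ i ∈ I, x = Cell.pos s.node i} ∪ {x | x ∈ s.cells ∧ x.focus φ ψ ≠ a},
      insert s.node s.fired, insert e s.used, insert (s.node, e.node I) s.bindings, s.index,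
      s.time + 1⟩ := by
  have haG : a ∈ G s.node := H.mem h
  have haU : a ∈ s.names G L := Or.inl haG
  have hsub : ∀ {i}, i ∈ I → ∀ {b}, b ∈ L (Cell.pos s.node i) → b ∈ G s.node ∧ b ≠ a :=
    fun hi b hb => (Finset.mem_erase.1 (H.sub h hi hb)).symm
  have hGe : ∀ {b}, b ∈ G (e.node I) → (∃ j ∈ I, b = a ++ [j]) ∨ b ∈ L e :=
    fun hb => hf ▸ H.node hs he I hb
  have hext : ∀ j, a ++ [j] ∉ s.names G L := fun j hj => by
    simpa using hs.names_wf a haU _ hj (List.prefix_append _ _)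
  have hfoc : ∀ i, (Cell.pos s.node i).focus φ ψ = a ++ [i] := Cell.focus_pos h
  have haL : ∀ e' ∈ s.cells, a ∉ L e' := fun e' he' => hs.code_disj e' he' a haG
  have hξa : ψ.focus <+: a := hf ▸ hs.focus_ext e he
  have hne : ∀ x ∈ s.cells, x.focus φ ψ ≠ a → x ≠ e := fun x _ hx hxe => hx (hxe ▸ hf)
  have heF : e.node I ∉ s.fired := fun hF =>
    hs.cells_used e he (by simpa using hs.fired_used _ hF)
  have hnames : ∀ b, (b ∈ G (e.node I) ∨ ∃ x ∈ ({x | ∃ i ∈ I, x = Cell.pos s.node i} ∪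
      {x | x ∈ s.cells ∧ x.focus φ ψ ≠ a} : Set Cell), b ∈ L x) →
      (b ∈ s.names G L ∧ b ≠ a) ∨ ∃ j ∈ I, b = a ++ [j] := by
    rintro b (hb | ⟨x, ⟨i, hi, rfl⟩ | ⟨hx, hxa⟩, hb⟩)
    · rcases hGe hb with hb | hb
      · exact Or.inr hb
      · exact Or.inl ⟨Or.inr ⟨e, he, hb⟩, fun hba => haL e he (hba ▸ hb)⟩
    · exact Or.inl ⟨Or.inl (hsub hi hb).1, (hsub hi hb).2⟩
    · exact Or.inl ⟨Or.inr ⟨x, hx, hb⟩, fun hba => haL x hx (hba ▸ hb)⟩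
  constructor
  · rintro x (⟨i, hi, rfl⟩ | ⟨hx, hxa⟩) y (⟨j, hj, rfl⟩ | ⟨hy, hya⟩) hp
    · rw [hfoc, hfoc] at hp
      have := hp.eq_of_length (by simp)
      simp at this
      rw [this]
    · rw [hfoc] at hp
      exact absurd (hs.focus_inj e he y hy (hf ▸ (List.prefix_append _ _).trans hp)).symm
        (hne y hy hya)
    · rw [hfoc] at hp
      rcases List.prefix_concat_iff.1 hp with h' | h'
      · refine absurd (hs.focus_inj e he x hx ?_).symm (hne x hx hxa)
        rw [hf, h']
        exact List.prefix_append _ _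
      · exact absurd (hs.focus_inj x hx e he (hf ▸ h')) (hne x hx hxa)
    · exact hs.focus_inj x hx y hy hp
  · rintro x (⟨i, hi, rfl⟩ | ⟨hx, hxa⟩) b hb hbx
    · rcases hGe hb with ⟨j, hj, rfl⟩ | hb
      · exact hext j (Or.inl (hsub hi hbx).1)
      · exact hs.code_disj e he b (hsub hi hbx).1 hb
    · rcases hGe hb with ⟨j, hj, rfl⟩ | hb
      · exact hext j (Or.inr ⟨x, hx, hbx⟩)
      · exact hne x hx hxa (hs.env_disj x hx e he b hbx hb)
  · rintro x (⟨i, hi, rfl⟩ | ⟨hx, hxa⟩) y (⟨j, hj, rfl⟩ | ⟨hy, hya⟩) b hbx hby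
    · by_contra hij
      exact Finset.disjoint_left.1 (H.disj h hi hj fun hij' => hij (by rw [hij'])) hbx hby
    · exact absurd hby (hs.code_disj y hy b (hsub hi hbx).1)
    · exact absurd hbx (hs.code_disj x hx b (hsub hj hby).1)
    · exact hs.env_disj x hx y hy b hbx hby
  · refine prefix_antichain_extend hs.names_wf haU (d := 1) fun x hx => ?_
    rcases hnames x hx with hx | ⟨j, -, rfl⟩
    · exact Or.inl hx
    · exact Or.inr ⟨[j], rfl, rfl⟩
  · intro b hb hc
    rcases hnames b hb with ⟨hb, hba⟩ | ⟨j, hj, rfl⟩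
    · obtain ⟨x, hx, hxb⟩ := hs.accepted b hb hc
      exact ⟨x, Or.inr ⟨hx, hxb ▸ hba⟩, hxb⟩
    · exact ⟨_, Or.inl ⟨j, hj, rfl⟩, hfoc j⟩
  · rintro x (⟨i, hi, rfl⟩ | ⟨hx, hxa⟩)
    · rw [hfoc]
      exact hξa.trans (List.prefix_append _ _)
    · exact hs.focus_ext x hx
  · rintro n i (⟨j, hj, hx⟩ | ⟨hx, hxa⟩)
    · cases hx
      exact ⟨Or.inl rfl, a, I, h, hj, hξa⟩
    · exact ⟨Or.inr (hs.cells_pos n i hx).1, (hs.cells_pos n i hx).2⟩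
  · rintro x (⟨i, hi, rfl⟩ | ⟨hx, hxa⟩) (hu | hu)
    · subst hu
      exact hs.node_fired (hs.cells_pos _ _ he).1
    · exact hs.node_fired (hs.used_pos _ _ hu)
    · exact hne x hx hxa hu
    · exact hs.cells_used x hx hu
  · exact Or.inr hs.start_used
  · rintro n i (hu | hu)
    · subst hu
      exact Or.inr (hs.cells_pos _ _ he).1
    · exact Or.inr (hs.used_pos _ _ hu)
  · rintro n (rfl | hn)
    · exact Or.inr hs.node_used
    · exact Or.inr (hs.fired_used n hn)
  · rintro (hn | hn)
    · refine hs.cells_used e he ?_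
      have := hs.node_used
      rw [← hn] at this
      simpa using this
    · exact heF hn
  · exact Or.inl (Cell.cell_node e I)
  · rintro b hb x (⟨i, hi, rfl⟩ | ⟨hx, hxa⟩) hxb
    -- The negative occurrence pointed to is the one just entered, which has just been bound to
    -- `s.node`.
    · exact ⟨e.node I, a, I, Node.Below.refl _, hf ▸ negActionAt_node hs he I, hfoc i, Or.inl rfl⟩
    · rcases hGe hb with ⟨j, hj, rfl⟩ | hb
      · refine absurd (hs.focus_inj e he x hx ?_).symm (hne x hx hxa)
        rw [hf, hxb]
        exact List.prefix_append _ _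
      · exact (hs.link_env e he b hb x hx hxb I).mono (Set.subset_insert _ _) (Node.Below.refl _)
  · rintro y hy b hb x (⟨i, hi, rfl⟩ | ⟨hx, hxa⟩) hxb J
    · rw [hfoc] at hxb
      subst hxb
      -- No old cell or child can own the new address `a i`: its proper prefix `a` was already a
      -- name.
      refine absurd ?_ (hext i)
      rcases hy with ⟨j, hj, rfl⟩ | ⟨hy, -⟩
      · exact Or.inl (hsub hj hb).1
      · exact Or.inr ⟨y, hy, hb⟩
    · rcases hy with ⟨j, hj, rfl⟩ | ⟨hy, -⟩
      · exact (hs.link_code b (hsub hj hb).1 x hx hxb).mono (Set.subset_insert _ _)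
          (Node.below_ext _ _ _)
      · exact (hs.link_env y hy b hb x hx hxb J).mono (Set.subset_insert _ _) (Node.Below.refl _)
  · rintro u v (hu | hu)
    · cases hu
      exact Or.inl (Cell.cell_node e I)
    · exact Or.inr (hs.bound_used u v hu)
  · have hno : ∀ u, (u, e.node I) ∉ s.bindings := fun u hu =>
      hs.cells_used e he (by simpa using hs.bound_used _ _ hu)
    rintro u u' v (hu | hu) (hu' | hu')
    · cases hu; cases hu'; rfl
    · cases hu; exact absurd hu' (hno _)
    · cases hu'; exact absurd hu (hno _)
    · exact hs.bound_unique u u' v hu hu'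
  · rintro u v (hu | hu) ζ J hζ
    · cases hu
      rw [hζ.unique (negActionAt_node hs he I), hf]
      exact hξa
    · exact hs.bound_focus u v hu ζ J hζ

/-- A focus which is not accepted by the environment is not comparable with the address of the
cut. -/
theorem Cfg.Inv.free_incomparable (H : Contexts φ ψ G L) {s : Cfg} (hs : s.Inv φ ψ G L)
    {a : Address} {I : Ram} (h : actionAt φ ψ s.node = PosAction.proper a I)
    (hn : ∀ e ∈ s.cells, e.focus φ ψ ≠ a) (w : Address) :
    ¬ (a ++ w <+: ψ.focus ∨ ψ.focus <+: a ++ w) := by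
  have key : ¬ (a <+: ψ.focus ∨ ψ.focus <+: a) := fun hc => by
    obtain ⟨e, he, hf⟩ := hs.accepted a (Or.inl (H.mem h)) hc
    exact hn e he hf
  rintro (hc | hc)
  · exact key (Or.inl ((List.prefix_append _ _).trans hc))
  · exact key (List.prefix_or_prefix_of_prefix (List.prefix_append _ _) hc)

/-- Every extension of `a` is incomparable with the address of the cut, which all foci of the
environment extend; the new addresses thus never interact with the environment. -/
theorem Cfg.Inv.free (H : Contexts φ ψ G L) {s : Cfg} (hs : s.Inv φ ψ G L) {a : Address} {I : Ram}
    {i : ℕ} {J : Ram} (h : actionAt φ ψ s.node = PosAction.proper a I)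
    (hn : ∀ e ∈ s.cells, e.focus φ ψ ≠ a) (hi : i ∈ I) (q : List Action) :
    Cfg.Inv φ ψ G L ⟨s.node.ext i J, s.cells, insert s.node s.fired,
      insert (Cell.pos s.node i) s.used, s.bindings, q, s.time + 1⟩ := by
  have haG : a ∈ G s.node := H.mem h
  have haU : a ∈ s.names G L := Or.inl haG
  have hsub : ∀ {b}, b ∈ L (Cell.pos s.node i) → b ∈ G s.node ∧ b ≠ a :=
    fun hb => (Finset.mem_erase.1 (H.sub h hi hb)).symm
  have hGe : ∀ {b}, b ∈ G (s.node.ext i J) →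
      (∃ j, b = a ++ [i, j]) ∨ b ∈ L (Cell.pos s.node i) := by
    intro b hb
    rcases Finset.mem_union.1 (H.above h hi J hb) with hb | hb
    · obtain ⟨j, -, rfl⟩ := mem_locusStar.1 hb
      exact Or.inl ⟨j, by simp⟩
    · exact Or.inr hb
  have hinc := hs.free_incomparable H h hn
  have hfoc : ∀ e ∈ s.cells, ∀ w, e.focus φ ψ ≠ a ++ w := fun e he w hw =>
    hinc w (Or.inr (hw ▸ hs.focus_ext e he))
  have hnew : Cell.pos s.node i ∉ s.cells := fun hc => hs.node_fired (hs.cells_pos _ _ hc).1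
  have hnewU : Cell.pos s.node i ∉ s.used := fun hc => hs.node_fired (hs.used_pos _ _ hc)
  have hnames : ∀ b, (b ∈ G (s.node.ext i J) ∨ ∃ x ∈ s.cells, b ∈ L x) →
      (b ∈ s.names G L ∧ b ≠ a) ∨ ∃ j, b = a ++ [i, j] := by
    rintro b (hb | ⟨x, hx, hb⟩)
    · rcases hGe hb with hb | hb
      · exact Or.inr hb
      · exact Or.inl ⟨Or.inl (hsub hb).1, (hsub hb).2⟩
    · exact Or.inl ⟨Or.inr ⟨x, hx, hb⟩, fun hba => hs.code_disj x hx a haG (hba ▸ hb)⟩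
  constructor
  · exact hs.focus_inj
  · rintro x hx b hb hbx
    rcases hGe hb with ⟨j, rfl⟩ | hb
    · have := hs.names_wf a haU _ (Or.inr ⟨x, hx, hbx⟩) (List.prefix_append _ _)
      simp at this
    · exact hs.code_disj x hx b (hsub hb).1 hbx
  · exact hs.env_disj
  · refine prefix_antichain_extend hs.names_wf haU (d := 2) fun x hx => ?_
    rcases hnames x hx with hx | ⟨j, rfl⟩
    · exact Or.inl hx
    · exact Or.inr ⟨[i, j], rfl, rfl⟩
  · intro b hb hc
    rcases hnames b hb with ⟨hb, -⟩ | ⟨j, rfl⟩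
    · exact hs.accepted b hb hc
    · exact absurd hc (hinc _)
  · exact hs.focus_ext
  · exact fun n j hx => ⟨Or.inr (hs.cells_pos n j hx).1, (hs.cells_pos n j hx).2⟩
  · rintro x hx (rfl | hu)
    · exact hnew hx
    · exact hs.cells_used x hx hu
  · exact Or.inr hs.start_used
  · rintro n j (hu | hu)
    · cases hu
      exact Or.inl rfl
    · exact Or.inr (hs.used_pos _ _ hu)
  · rintro n (rfl | hn)
    · exact Or.inr hs.node_used
    · exact Or.inr (hs.fired_used n hn)
  · rintro (hn | hn)
    · refine hnewU ?_
      have := hs.node_used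
      rw [← hn] at this
      simpa using this
    · exact hnewU (by simpa using hs.fired_used _ hn)
  · exact Or.inl (Node.cell_ext _ _ _)
  · rintro b hb x hx hxb
    rcases hGe hb with ⟨j, rfl⟩ | hb
    · exact absurd hxb (hfoc x hx _)
    · exact (hs.link_code b (hsub hb).1 x hx hxb).mono subset_rfl (Node.below_ext _ _ _)
  · exact hs.link_env
  · exact fun u v hu => Or.inr (hs.bound_used u v hu)
  · exact hs.bound_unique
  · exact hs.bound_focus

theorem Cfg.Inv.step (H : Contexts φ ψ G L) {s s' : Cfg} (hs : s.Inv φ ψ G L)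
    (h : Cfg.Step φ ψ s s') : s'.Inv φ ψ G L := by
  cases h with
  | cut a I e h he hf => exact hs.cut H h he hf
  | free a I i J h hn hi => exact hs.free H h hn hi _

theorem Cfg.Inv.steps (H : Contexts φ ψ G L) {s s' : Cfg} (hs : s.Inv φ ψ G L)
    (h : Cfg.Steps φ ψ s s') : s'.Inv φ ψ G L := by
  induction h with
  | refl => exact hs
  | tail _ h ih => exact ih.step H h

end

/-! ### Each subdesign is entered at most once -/

section
variable {φ : PosDesign} {ψ : NegDesign} {G : Node → Finset Address} {L : Cell → Finset Address}

theorem Cfg.Steps.index_prefix {s s' : Cfg} (h : Cfg.Steps φ ψ s s') : s.index <+: s'.index := by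
  induction h with
  | refl => exact List.prefix_rfl
  | tail _ h ih =>
    cases h with
    | cut => exact ih
    | free => exact ih.trans (List.prefix_append _ _)

theorem Cfg.Step.used_subset {s s' : Cfg} (h : Cfg.Step φ ψ s s') : s.used ⊆ s'.used := by
  cases h <;> exact Set.subset_insert _ _

theorem Cfg.Steps.used_subset {s s' : Cfg} (h : Cfg.Steps φ ψ s s') : s.used ⊆ s'.used := by
  induction h with
  | refl => exact subset_rfl
  | tail _ h ih => exact ih.trans h.used_subset

/-- A cut enters a cell of the environment, and these are unused; a free step enters a child of a
node which had not yet been fired. -/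
theorem Cfg.Inv.step_fresh {s s' : Cfg} (hs : s.Inv φ ψ G L) (h : Cfg.Step φ ψ s s') :
    s'.node.cell ∉ s.used := by
  cases h with
  | cut a I e h he hf => simpa using hs.cells_used e he
  | free a I i J h hn hi =>
    intro hu
    exact hs.node_fired (hs.used_pos _ _ (by simpa using hu))

/-- `P` is a part of the environment which contains all that the code may ever call. -/
structure Cfg.Owned (φ : PosDesign) (ψ : NegDesign) (G : Node → Finset Address)
    (L : Cell → Finset Address) (s : Cfg) (P : Set Cell) : Prop where
  sub : P ⊆ s.cells
  code : ∀ a ∈ G s.node, ∀ e ∈ s.cells, e.focus φ ψ = a → e ∈ P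
  env : ∀ e' ∈ P, ∀ a ∈ L e', ∀ e ∈ s.cells, e.focus φ ψ = a → e ∈ P

/-- The part of the environment which may be called after a free action, when the opponent
chooses the child number `i`. -/
inductive Cfg.Part (φ : PosDesign) (ψ : NegDesign) (L : Cell → Finset Address) (s : Cfg) (i : ℕ) :
    Cell → Prop where
  | code (e : Cell) (he : e ∈ s.cells) (h : e.focus φ ψ ∈ L (Cell.pos s.node i)) :
      Cfg.Part φ ψ L s i e
  | env (e e' : Cell) (he : e ∈ s.cells) (he' : Cfg.Part φ ψ L s i e') (h : e.focus φ ψ ∈ L e') :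
      Cfg.Part φ ψ L s i e

theorem Cfg.Part.mem {s : Cfg} {i : ℕ} {e : Cell} (h : Cfg.Part φ ψ L s i e) : e ∈ s.cells := by
  cases h <;> assumption

/-- Follow the two chains of calls backwards from `e`. Each address having one owner, the callers
coincide as long as both are cells, and a cell cannot share an address with the code; so the chains
would start from a common address of the disjoint contexts of children `i` and `j`. -/
theorem Cfg.Part.disjoint (H : Contexts φ ψ G L) {s : Cfg} (hs : s.Inv φ ψ G L) {a : Address}
    {I : Ram} (h : actionAt φ ψ s.node = PosAction.proper a I) {i j : ℕ} (hi : i ∈ I) (hj : j ∈ I)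
    (hij : i ≠ j) {e : Cell} (hp : Cfg.Part φ ψ L s i e) : ¬ Cfg.Part φ ψ L s j e := by
  have hsub : ∀ {i}, i ∈ I → ∀ {b}, b ∈ L (Cell.pos s.node i) → b ∈ G s.node :=
    fun hi b hb => (Finset.mem_erase.1 (H.sub h hi hb)).2
  induction hp with
  | code e he hL =>
    intro hq
    cases hq with
    | code _ _ hL' => exact Finset.disjoint_left.1 (H.disj h hi hj hij) hL hL'
    | env _ e' _ he' hL' => exact hs.code_disj e' he'.mem _ (hsub hi hL) hL'
  | env e e' he he' hL ih =>
    intro hq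
    cases hq with
    | code _ _ hL' => exact hs.code_disj e' he'.mem _ (hsub hj hL') hL
    | env _ e'' _ he'' hL' =>
      obtain rfl := hs.env_disj e' he'.mem e'' he''.mem _ hL hL'
      exact ih he''

/-- The addresses created by a free action cannot call the environment; only inherited ones can. -/
theorem Cfg.Inv.mem_code_free (H : Contexts φ ψ G L) {s : Cfg} (hs : s.Inv φ ψ G L) {a : Address}
    {I : Ram} {i : ℕ} {J : Ram} (h : actionAt φ ψ s.node = PosAction.proper a I)
    (hn : ∀ e ∈ s.cells, e.focus φ ψ ≠ a) (hi : i ∈ I) {e : Cell} (he : e ∈ s.cells)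
    (hb : e.focus φ ψ ∈ G (s.node.ext i J)) : e.focus φ ψ ∈ L (Cell.pos s.node i) := by
  rcases Finset.mem_union.1 (H.above h hi J hb) with hb | hb
  · obtain ⟨j, -, hj⟩ := mem_locusStar.1 hb
    rw [List.append_assoc] at hj
    exact absurd (Or.inr (hj ▸ hs.focus_ext e he)) (hs.free_incomparable H h hn ([i] ++ [j]))
  · exact hb

/-- A set of cells which the run from `s` does not use. -/
structure Cfg.Avoids (φ : PosDesign) (ψ : NegDesign) (G : Node → Finset Address)
    (L : Cell → Finset Address) (X : Set Cell) (Y : Set Node) (s : Cfg) : Prop where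
  owned : ∃ P, s.Owned φ ψ G L P ∧ ∀ e ∈ P, e ∉ X
  node : s.node.cell ∉ X
  -- `Y` contains the nodes whose children may lie in `X`. The current node, neither in a cell of
  -- `X` nor fired, is outside `Y`, so its children are outside `X`.
  fired : ∀ u ∈ Y, u.cell ∈ X ∨ u ∈ s.fired

theorem Cfg.Avoids.step (H : Contexts φ ψ G L) {X : Set Cell} {Y : Set Node}
    (hX : ∀ n i, Cell.pos n i ∈ X → n ∈ Y) {s s' : Cfg} (hs : s.Inv φ ψ G L)
    (hA : s.Avoids φ ψ G L X Y) (hst : Cfg.Step φ ψ s s') :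
    s'.Avoids φ ψ G L X Y ∧ ∀ e ∈ X, e ∈ s'.used → e ∈ s.used := by
  obtain ⟨⟨P, hP, hPX⟩, hnode, hfired⟩ := hA
  have hnew : ∀ i, Cell.pos s.node i ∉ X := fun i hi =>
    (hfired _ (hX _ _ hi)).elim hnode hs.node_fired
  cases hst with
  | cut a I e h he hf =>
    have heP : e ∈ P := hP.code a (H.mem h) e he hf
    refine ⟨⟨⟨{x | ∃ i ∈ I, x = Cell.pos s.node i} ∪ {x | x ∈ P ∧ x.focus φ ψ ≠ a},
      ⟨?_, ?_, ?_⟩, ?_⟩, ?_, ?_⟩, ?_⟩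
    · exact Set.union_subset_union_right _ fun x hx => ⟨hP.sub hx.1, hx.2⟩
    · rintro b hb x (hx | ⟨hx, hxa⟩) hxb
      · exact Or.inl hx
      · refine Or.inr ⟨?_, hxa⟩
        rcases H.node hs he I hb with ⟨j, -, rfl⟩ | hb
        · exact absurd (hs.focus_inj e he x hx (hxb ▸ List.prefix_append _ _))
            fun hex => hxa (hex ▸ hf)
        · exact hP.env e heP b hb x hx hxb
    · rintro y hy b hb x (hx | ⟨hx, hxa⟩) hxb
      · exact Or.inl hx
      · refine Or.inr ⟨?_, hxa⟩
        rcases hy with ⟨i, hi, rfl⟩ | ⟨hy, -⟩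
        · exact hP.code b (Finset.mem_of_mem_erase (H.sub h hi hb)) x hx hxb
        · exact hP.env y hy b hb x hx hxb
    · rintro x (⟨i, hi, rfl⟩ | ⟨hx, -⟩)
      · exact hnew i
      · exact hPX x hx
    · simpa using hPX e heP
    · exact fun u hu => (hfired u hu).imp_right Or.inr
    · rintro x hx (rfl | hu)
      · exact absurd hx (hPX _ heP)
      · exact hu
  | free a I i J h hn hi =>
    refine ⟨⟨⟨P, ⟨hP.sub, ?_, hP.env⟩, hPX⟩, ?_, ?_⟩, ?_⟩
    · rintro b hb x hx rfl
      exact hP.code _ (Finset.mem_of_mem_erase (H.sub h hi (hs.mem_code_free H h hn hi hx hb)))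
        x hx rfl
    · simpa using hnew i
    · exact fun u hu => (hfired u hu).imp_right Or.inr
    · rintro x hx (rfl | hu)
      · exact absurd hx (hnew i)
      · exact hu

theorem Cfg.Avoids.steps (H : Contexts φ ψ G L) {X : Set Cell} {Y : Set Node}
    (hX : ∀ n i, Cell.pos n i ∈ X → n ∈ Y) {s s' : Cfg} (hs : s.Inv φ ψ G L)
    (hA : s.Avoids φ ψ G L X Y) (hst : Cfg.Steps φ ψ s s') :
    s'.Avoids φ ψ G L X Y ∧ ∀ e ∈ X, e ∈ s'.used → e ∈ s.used := by
  induction hst with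
  | refl => exact ⟨hA, fun _ _ h => h⟩
  | tail h hst ih =>
    have := ih.1.step H hX (hs.steps H h) hst
    exact ⟨this.1, fun e he hu => ih.2 e he (this.2 e he hu)⟩

/-- After a free action, two runs in which the opponent chooses different children use disjoint
parts of the designs. -/
theorem Cfg.Inv.fork (H : Contexts φ ψ G L) {s : Cfg} (hs : s.Inv φ ψ G L) {a : Address}
    {I : Ram} (h : actionAt φ ψ s.node = PosAction.proper a I)
    (hn : ∀ e ∈ s.cells, e.focus φ ψ ≠ a) {i j : ℕ} (hi : i ∈ I) (hj : j ∈ I) (hij : i ≠ j)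
    {x y s₁ s₂ : Cfg} (hx : Cfg.Step φ ψ s x) (hy : Cfg.Step φ ψ s y)
    (hxc : x.cells = s.cells) (hyc : y.cells = s.cells)
    (hxf : x.fired = insert s.node s.fired)
    (hxu : x.used = insert (Cell.pos s.node i) s.used)
    {J K : Ram} (hxn : x.node = s.node.ext i J) (hyn : y.node = s.node.ext j K)
    (h₁ : Cfg.Steps φ ψ x s₁) (h₂ : Cfg.Steps φ ψ y s₂) : s₁.node.cell ≠ s₂.node.cell := by
  have hxI := hs.step H hx
  have hyI := hs.step H hy
  have howned : ∀ {i : ℕ} {J : Ram} {x : Cfg}, i ∈ I → x.cells = s.cells →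
      x.node = s.node.ext i J → x.Owned φ ψ G L {e | Cfg.Part φ ψ L s i e} := by
    intro i J x hi hxc hxn
    refine ⟨fun e he => hxc ▸ he.mem, ?_, ?_⟩
    · rintro b hb e he rfl
      rw [hxc] at he
      rw [hxn] at hb
      exact Cfg.Part.code e he (hs.mem_code_free H h hn hi he hb)
    · rintro e' he' b hb e he rfl
      rw [hxc] at he
      exact Cfg.Part.env e e' he he' hb
  have hcell : ∀ i, Cell.pos s.node i ∉ s.cells := fun i hc =>
    hs.node_fired (hs.cells_pos _ _ hc).1
  have hcellU : ∀ i, Cell.pos s.node i ∉ s.used := fun i hc =>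
    hs.node_fired (hs.used_pos _ _ hc)
  -- The first run avoids child `j` and all the environment that `j` may call.
  have A₁ : x.Avoids φ ψ G L (insert (Cell.pos s.node j) {e | Cfg.Part φ ψ L s j e})
      (insert s.node s.fired) := by
    refine ⟨⟨_, howned hi hxc hxn, ?_⟩, ?_, fun u hu => Or.inr (hxf ▸ hu)⟩
    · rintro e he (rfl | he')
      · exact hcell _ he.mem
      · exact he.disjoint H hs h hi hj hij he'
    · rw [hxn, Node.cell_ext]
      rintro (he | he)
      · cases he
        exact hij rfl
      · exact hcell _ he.mem
  have B₁ := (A₁.steps H (by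
    rintro n k (he | he)
    · cases he
      exact Or.inl rfl
    · exact Or.inr (hs.cells_pos _ _ he.mem).1) hxI h₁).2
  have hI₁ := hxI.steps H h₁
  -- Hence all that the second run may call was left unused by the first, so the second run avoids
  -- every cell used by the first.
  have A₂ : y.Avoids φ ψ G L s₁.used s₁.fired := by
    refine ⟨⟨_, howned hj hyc hyn, ?_⟩, ?_, fun u hu => Or.inl (hI₁.fired_used u hu)⟩
    · intro e he hu
      have := B₁ e (Or.inr he) hu
      rw [hxu] at this
      rcases this with rfl | this
      · exact hcell _ he.mem
      · exact hs.cells_used e he.mem this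
    · rw [hyn, Node.cell_ext]
      intro hu
      have := B₁ _ (Or.inl rfl) hu
      rw [hxu] at this
      rcases this with this | this
      · cases this
        exact hij rfl
      · exact hcellU _ this
  have := (A₂.steps H hI₁.used_pos hyI h₂).1.node
  exact fun hc => this (hc ▸ hI₁.node_used)

/-- In the chronicles of `R`, the ramification of a negative action is determined by the actions
below it and by its focus. -/
def DetRam (R : Set (List Action)) : Prop :=
  ∀ (q : List Action) (κ : PosAction) (a : Address) (J J' : Ram), ∀ r ∈ R, ∀ r' ∈ R,
    q ++ [Action.pos κ, Action.neg a J] <+: r → q ++ [Action.pos κ, Action.neg a J'] <+: r' → J = J'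

theorem reflTransGen_fork {α : Type*} {T : α → α → Prop} {x a b : α}
    (ha : Relation.ReflTransGen T x a) (hb : Relation.ReflTransGen T x b) :
    Relation.ReflTransGen T a b ∨ Relation.ReflTransGen T b a ∨
      ∃ s y z, Relation.ReflTransGen T x s ∧ T s y ∧ T s z ∧ y ≠ z ∧
        Relation.ReflTransGen T y a ∧ Relation.ReflTransGen T z b := by
  induction ha with
  | refl => exact Or.inl hb
  | @tail c d hc hd ih =>
    rcases ih with h | h | ⟨s, y, z, h₁, h₂, h₃, h₄, h₅, h₆⟩
    · rcases Relation.ReflTransGen.cases_head h with rfl | ⟨e, he, heb⟩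
      · exact Or.inr (Or.inl (Relation.ReflTransGen.single hd))
      · by_cases hde : d = e
        · exact Or.inl (hde ▸ heb)
        · exact Or.inr (Or.inr ⟨c, d, e, hc, hd, he, hde, Relation.ReflTransGen.refl, heb⟩)
    · exact Or.inr (Or.inl (h.tail hd))
    · exact Or.inr (Or.inr ⟨s, y, z, h₁, h₂, h₃, h₄, h₅.tail hd, h₆⟩)

/-- Two configurations of the exploration of `R` which sit above the same negative subdesign are
equal. -/
theorem Cfg.eq_of_cell_eq (H : Contexts φ ψ G L) (h₀ : Cfg.init.Inv φ ψ G L)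
    {R : Set (List Action)} (hR : DetRam R) {s₁ s₂ : Cfg} (h₁ : Cfg.Steps φ ψ Cfg.init s₁)
    (h₂ : Cfg.Steps φ ψ Cfg.init s₂) (hr₁ : ∃ r ∈ R, s₁.index <+: r)
    (hr₂ : ∃ r ∈ R, s₂.index <+: r) (hc : s₁.node.cell = s₂.node.cell) : s₁ = s₂ := by
  have key : ∀ {s₁ s₂ : Cfg}, Cfg.Steps φ ψ Cfg.init s₁ → Cfg.Steps φ ψ s₁ s₂ →
      s₁.node.cell = s₂.node.cell → s₁ = s₂ := by
    intro s₁ s₂ h₁ h hc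
    rcases Relation.ReflTransGen.cases_tail h with rfl | ⟨x, hx, hx'⟩
    · rfl
    · refine absurd ?_ ((h₀.steps H (h₁.trans hx)).step_fresh hx')
      rw [← hc]
      exact Cfg.Steps.used_subset hx (h₀.steps H h₁).node_used
  rcases reflTransGen_fork h₁ h₂ with h | h | ⟨s, x, y, hs, hx, hy, hxy, hx₁, hy₂⟩
  · exact key h₁ h hc
  · exact (key h₂ h hc.symm).symm
  exfalso
  have hsI := h₀.steps H hs
  have hx' := hx
  have hy' := hy
  -- Foci in the environment are distinct, so cuts are deterministic, and cuts and free steps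
  -- exclude each other: only two free steps can differ.
  cases hx with
  | cut a I e h he hf =>
    cases hy with
    | cut a' I' e' h' he' hf' =>
      rw [h] at h'
      cases h'
      obtain rfl := hsI.focus_inj e he e' he' (by rw [hf, hf'])
      exact hxy rfl
    | free a' I' i J h' hn hi =>
      rw [h] at h'
      cases h'
      exact hn e he hf
  | free a I i J h hn hi =>
    cases hy with
    | cut a' I' e h' he hf =>
      rw [h] at h'
      cases h'
      exact hn e he hf
    | free a' I' j K h' hn' hj =>
      rw [h] at h'
      cases h'
      by_cases hij : i = j
      · subst hij
        obtain ⟨r₁, hr₁, hp₁⟩ := hr₁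
        obtain ⟨r₂, hr₂, hp₂⟩ := hr₂
        obtain rfl := hR s.index _ _ J K r₁ hr₁ r₂ hr₂
          ((Cfg.Steps.index_prefix hx₁).trans hp₁) ((Cfg.Steps.index_prefix hy₂).trans hp₂)
        exact hxy rfl
      · exact hsI.fork H h hn hi hj hij hx' hy' rfl rfl rfl rfl rfl rfl hx₁ hy₂ hc

theorem DetRam.singleton (r : List Action) : DetRam {r} := by
  rintro q κ a J J' r₁ rfl r₂ rfl h h'
  have := (List.prefix_of_prefix_length_le h h' (by simp)).eq_of_length (by simp)
  simpa using this

theorem PosDesign.IsChronicle.head_ne {S : PosDesign} {r : List Action} (h : S.IsChronicle r) :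
    S.head [] ≠ PosAction.omega := by
  cases h <;> simp_all

theorem PosDesign.Multiplicative.detRam {S : PosDesign} (hS : S.Multiplicative) :
    DetRam S.chronicles := by
  intro q κ a J J' r hr r' hr' hp hp'
  change S.IsChronicle r at hr
  change S.IsChronicle r' at hr'
  induction hr generalizing q r' with
  | daimon S h =>
    have := hp.length_le
    simp at this
  | proper S ξ I h =>
    have := hp.length_le
    simp at this
  | cons S ξ I i K r h hi hr ih =>
    cases hr' with
    | daimon h' =>
      have := hp'.length_le
      simp at this
    | proper ξ' I' h' =>
      have := hp'.length_le
      simp at this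
    | cons _ ξ' I' i' K' r' h' hi' hr' =>
      rw [h] at h'
      cases h'
      match q with
      | [] =>
        simp only [List.nil_append, List.cons_prefix_cons, List.nil_prefix, and_true,
          Action.neg.injEq] at hp hp'
        obtain ⟨-, rfl, rfl⟩ := hp
        obtain ⟨-, hii, rfl⟩ := hp'
        obtain rfl : i = i' := by simpa using hii
        -- Both chronicles continue above this negative action, so neither ramification is followed
        -- by `Ω`.
        exact hS [] i J J' hr.head_ne hr'.head_ne
      | [x] =>
        simp at hp
      | x :: y :: q =>
        simp only [List.cons_append, List.cons_prefix_cons] at hp hp'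
        obtain ⟨-, rfl, hp⟩ := hp
        obtain ⟨-, hy, hp'⟩ := hp'
        simp only [Action.neg.injEq, List.append_cancel_left_eq, List.cons.injEq, and_true] at hy
        obtain ⟨rfl, rfl⟩ := hy
        exact ih (fun p => hS ((i, K) :: p)) q r' hp hp' hr'

end

/-! ### From configurations to tokens, states and pull-backs -/

section
variable {φ : PosDesign} {ψ : NegDesign} {G : Node → Finset Address} {L : Cell → Finset Address}

/-! ### Token machine -/

/-- By `accepted`, a positive action with a pointer to a bound occurrence finds a cell of its focus,
and `link_code` supplies a pointer and a binding leading to that cell. They agree with the given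
ones because foci are distinct along a branch and a negative occurrence has one binding. -/
theorem Cfg.Inv.cutAgainst_iff (H : Contexts φ ψ G L) {s : Cfg} (hs : s.Inv φ ψ G L) {a : Address}
    {I : Ram} (h : actionAt φ ψ s.node = PosAction.proper a I) {m : Node} :
    CutAgainst φ ψ s.bindings I s.node m ↔
      ∃ e ∈ s.cells, e.focus φ ψ = a ∧ m = e.node I := by
  have haG := H.mem h
  -- Foci of children are strictly longer than the address of the cut, so only `root` can answer
  -- that address.
  have hpos : ∀ n i, Cell.pos n i ∈ s.cells → (Cell.pos n i).focus φ ψ ≠ ψ.focus := by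
    intro n i hc hf
    obtain ⟨-, b, I', hb, -, hp⟩ := hs.cells_pos n i hc
    rw [Cell.focus_pos hb] at hf
    rw [← hf] at hp
    simpa using hp.length_le
  constructor
  · intro hm
    generalize hn : s.node = n at hm
    cases hm with
    | root p hp =>
      rw [hn] at h
      obtain rfl : ψ.focus = a := by
        have : PosAction.proper ψ.focus I = PosAction.proper a I := hp.symm.trans h
        cases this
        rfl
      obtain ⟨e, he, hf⟩ := hs.accepted _ (Or.inl haG) (Or.inl List.prefix_rfl)
      refine ⟨e, he, hf, ?_⟩
      cases e with
      | start => exact absurd hs.start_used (hs.cells_used _ he)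
      | root => rfl
      | pos n i => exact absurd hf (hpos n i he)
    | bound _ u v i hp hB =>
      obtain ⟨ζ, I', J, hζ, hv, hneg⟩ := hp
      rw [← hn, h] at hζ
      cases hζ
      have hξ := hs.bound_focus u v hB ζ J hneg
      obtain ⟨e, he, hf⟩ := hs.accepted _ (Or.inl haG)
        (Or.inr (hξ.trans (List.prefix_append _ _)))
      refine ⟨e, he, hf, ?_⟩
      have hl := hs.link_code _ haG e he hf
      cases e with
      | start => exact hl.elim
      | root =>
        have : ψ.focus = ζ ++ [i] := hf
        rw [this] at hξ
        simpa using hξ.length_le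
      | pos u' i' =>
        obtain ⟨v', ζ', J', hv', hneg', hf', hB'⟩ := hl
        rw [hf] at hf'
        obtain ⟨rfl, hii⟩ := List.append_inj' hf' rfl
        cases hii
        obtain rfl := H.below_unique (hn ▸ hv) hv' hneg hneg'
        rw [hs.bound_unique u u' v hB hB']
        rfl
  · rintro ⟨e, he, hf, rfl⟩
    have hl := hs.link_code a haG e he hf
    cases e with
    | start => exact hl.elim
    | root =>
      generalize hn : s.node = n at *
      obtain ⟨c, p⟩ := n
      obtain rfl : c = none := hl
      refine CutAgainst.root p ?_
      rw [show ψ.focus = a from hf]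
      exact h
    | pos u i =>
      obtain ⟨v, ζ, J, hv, hneg, hf', hB⟩ := hl
      exact CutAgainst.bound _ u v i ⟨ζ, I, J, by rw [h, ← hf, hf'], hv, hneg⟩ hB

/-- One step is two moves: to a negative occurrence, then up. The subtraction does not truncate,
since at time 0 the node is the root of `φ`. -/
theorem Cfg.Steps.tokenReach (H : Contexts φ ψ G L) (h₀ : Cfg.init.Inv φ ψ G L) {s : Cfg}
    (h : Cfg.Steps φ ψ Cfg.init s) :
    TokenReach φ ψ (2 * s.time) ⟨Sign.plus, s.node, s.bindings, s.index⟩ ∧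
      (s.node ≠ ⟨none, []⟩ →
        TokenReach φ ψ (2 * s.time - 1) ⟨Sign.minus, s.node, s.bindings, s.index⟩) := by
  induction h with
  | refl => exact ⟨TokenReach.start, fun h => absurd rfl h⟩
  | @tail s s' hs hst ih =>
    have hI := h₀.steps H hs
    have key : ∀ {s' : Cfg}, s'.time = s.time + 1 →
        TokenStep φ ψ ⟨Sign.plus, s.node, s.bindings, s.index⟩
          ⟨Sign.minus, s'.node, s'.bindings, s'.index⟩ →
        TokenReach φ ψ (2 * s'.time) ⟨Sign.plus, s'.node, s'.bindings, s'.index⟩ ∧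
        (s'.node ≠ ⟨none, []⟩ →
          TokenReach φ ψ (2 * s'.time - 1) ⟨Sign.minus, s'.node, s'.bindings, s'.index⟩) := by
      intro s' ht hts
      have h₁ := TokenReach.step _ _ _ ih.1 hts
      rw [ht]
      exact ⟨TokenReach.step _ _ _ h₁ (TokenStep.up _ _ _), fun _ => h₁⟩
    cases hst with
    | cut a I e h he hf =>
      exact key rfl (TokenStep.cut _ _ _ _ a I h ((hI.cutAgainst_iff H h).2 ⟨e, he, hf, rfl⟩))
    | free a I i J h hn hi =>
      refine key rfl (TokenStep.free _ _ _ a I i J h (fun m hm => ?_) hi)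
      obtain ⟨e, he, hf, -⟩ := (hI.cutAgainst_iff H h).1 hm
      exact hn e he hf

/-- A token on a negative occurrence is matched with the configuration it is about to complete, one
move ahead; hence `k + 1`. -/
theorem TokenReach.exists_cfg (H : Contexts φ ψ G L) (h₀ : Cfg.init.Inv φ ψ G L) {k : ℕ}
    {t : Token} (h : TokenReach φ ψ k t) :
    ∃ s, Cfg.Steps φ ψ Cfg.init s ∧ t = ⟨t.sign, s.node, s.bindings, s.index⟩ ∧
      ((t.sign = Sign.plus ∧ k = 2 * s.time) ∨ (t.sign = Sign.minus ∧ k + 1 = 2 * s.time)) := by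
  induction h with
  | start => exact ⟨Cfg.init, Relation.ReflTransGen.refl, rfl, Or.inl ⟨rfl, rfl⟩⟩
  | step k t t' _ hs ih =>
    obtain ⟨s, hst, ht, hk⟩ := ih
    have hI := h₀.steps H hst
    cases hs with
    | up n B q =>
      cases ht
      refine ⟨s, hst, rfl, Or.inl ⟨rfl, ?_⟩⟩
      rcases hk with ⟨hk, -⟩ | ⟨-, hk⟩
      · cases hk
      · exact hk
    | cut n m B q a I h hm =>
      cases ht
      rcases hk with ⟨-, hk⟩ | ⟨hk, -⟩
      · obtain ⟨e, he, hf, rfl⟩ := (hI.cutAgainst_iff H h).1 hm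
        exact ⟨_, hst.tail (Cfg.Step.cut s a I e h he hf), rfl,
          Or.inr ⟨rfl, by simp only; omega⟩⟩
      · cases hk
    | free n B q a I i J h hn hi =>
      cases ht
      rcases hk with ⟨-, hk⟩ | ⟨hk, -⟩
      · refine ⟨_, hst.tail (Cfg.Step.free s a I i J h (fun e he hf => ?_) hi), rfl,
          Or.inr ⟨rfl, by simp only; omega⟩⟩
        exact hn _ ((hI.cutAgainst_iff H h).2 ⟨e, he, hf, rfl⟩)
      · cases hk

/-! ### Environment machine -/

/-- The tree above a node of `φ` or `ψ`. -/
def subAt (φ : PosDesign) (ψ : NegDesign) (n : Node) : PosDesign where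
  head p := actionAt φ ψ ⟨n.comp, n.path ++ p⟩
  tree p i J h := by
    refine actionAt_tree (n := ⟨n.comp, n.path ++ p⟩) (i := i) (J := J) ?_
    simpa [Node.ext] using h

theorem subAt_head_nil (φ : PosDesign) (ψ : NegDesign) (n : Node) :
    (subAt φ ψ n).head [] = actionAt φ ψ n := by
  simp [subAt]

theorem subAt_sub (φ : PosDesign) (ψ : NegDesign) (n : Node) (i : ℕ) (J : Ram) :
    (subAt φ ψ n).sub i J = subAt φ ψ (n.ext i J) := by
  ext p
  simp [subAt, PosDesign.sub, Node.ext]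

/-- The state `⟨code | environment⟩` which a configuration stands for, when the subtrees are taken
in `φ'` and `ψ'`. -/
def Cfg.toState (φ : PosDesign) (ψ : NegDesign) (φ' : PosDesign) (ψ' : NegDesign) (s : Cfg) :
    State :=
  ⟨subAt φ' ψ' s.node,
    -- Foci are taken in `φ` and `ψ` even when the trees come from `φ'` and `ψ'`, so acceptance is
    -- the same in both.
    {χ | ∃ e ∈ s.cells, χ = ⟨e.focus φ ψ, fun J => subAt φ' ψ' (e.node J)⟩}, s.index⟩

theorem Cfg.accepts_toState {φ' : PosDesign} {ψ' : NegDesign} {s : Cfg} {a : Address} :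
    Accepts (s.toState φ ψ φ' ψ').env a ↔ ∃ e ∈ s.cells, e.focus φ ψ = a := by
  constructor
  · rintro ⟨_, ⟨e, he, rfl⟩, hf⟩
    exact ⟨e, he, hf⟩
  · rintro ⟨e, he, hf⟩
    exact ⟨_, ⟨e, he, rfl⟩, hf⟩

theorem Cfg.toState_init {φ' : PosDesign} {ψ' : NegDesign} (hf : ψ'.focus = ψ.focus) :
    Cfg.init.toState φ ψ φ' ψ' = ⟨φ', {ψ'}, []⟩ := by
  have h₁ : subAt φ' ψ' ⟨none, []⟩ = φ' := by
    ext p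
    rfl
  have h₂ : (⟨ψ.focus, fun J => subAt φ' ψ' ⟨some J, []⟩⟩ : NegDesign) = ψ' := by
    refine NegDesign.ext hf.symm ?_
    funext J
    ext p
    rfl
  simp only [Cfg.toState, Cfg.init, Set.mem_singleton_iff, exists_eq_left, State.mk.injEq, h₁,
    true_and, and_true]
  ext χ
  simp only [Set.mem_ofPred_eq, Set.mem_singleton_iff]
  change χ = ⟨ψ.focus, fun J => subAt φ' ψ' ⟨some J, []⟩⟩ ↔ _
  rw [h₂]

/-- The configuration reached by a cut against the subdesign `e`. -/
def Cfg.afterCut (φ : PosDesign) (ψ : NegDesign) (s : Cfg) (a : Address) (I : Ram) (e : Cell) :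
    Cfg :=
  ⟨e.node I, {x | ∃ i ∈ I, x = Cell.pos s.node i} ∪ {x | x ∈ s.cells ∧ x.focus φ ψ ≠ a},
    insert s.node s.fired, insert e s.used, insert (s.node, e.node I) s.bindings, s.index,
    s.time + 1⟩

theorem Cfg.toState_afterCut_env {φ' : PosDesign} {ψ' : NegDesign} {s : Cfg} {a : Address}
    {I : Ram} {e : Cell} (h : actionAt φ ψ s.node = PosAction.proper a I) :
    ((s.afterCut φ ψ a I e).toState φ ψ φ' ψ').env =
      {χ | ∃ i ∈ I, χ = (subAt φ' ψ' s.node).child a i} ∪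
        {χ | χ ∈ (s.toState φ ψ φ' ψ').env ∧ χ.focus ≠ a} := by
  have hchild : ∀ i, (⟨(Cell.pos s.node i).focus φ ψ,
      fun J => subAt φ' ψ' ((Cell.pos s.node i).node J)⟩ : NegDesign) =
        (subAt φ' ψ' s.node).child a i := by
    intro i
    refine NegDesign.ext (Cell.focus_pos h i) ?_
    funext J
    exact (subAt_sub _ _ _ _ _).symm
  ext χ
  constructor
  · rintro ⟨x, ⟨i, hi, rfl⟩ | ⟨hx, hxa⟩, rfl⟩
    · exact Or.inl ⟨i, hi, hchild i⟩
    · exact Or.inr ⟨⟨x, hx, rfl⟩, hxa⟩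
  · rintro (⟨i, hi, rfl⟩ | ⟨⟨x, hx, rfl⟩, hxa⟩)
    · exact ⟨_, Or.inl ⟨i, hi, rfl⟩, (hchild i).symm⟩
    · exact ⟨x, Or.inr ⟨hx, hxa⟩, rfl⟩

theorem Cfg.stepR_toState {φ' : PosDesign} {ψ' : NegDesign} {s : Cfg} {a : Address} {I : Ram}
    {e : Cell} (h : actionAt φ ψ s.node = PosAction.proper a I) (he : e ∈ s.cells)
    (hf : e.focus φ ψ = a) (h' : actionAt φ' ψ' s.node = actionAt φ ψ s.node) :
    StepR (s.toState φ ψ φ' ψ') ((s.afterCut φ ψ a I e).toState φ ψ φ' ψ') := by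
  have := StepR.mk (subAt φ' ψ' s.node) (s.toState φ ψ φ' ψ').env s.index a I _
    (by rw [subAt_head_nil, h', h]) ⟨e, he, rfl⟩ hf
  rw [← Cfg.toState_afterCut_env (e := e) h] at this
  exact this

theorem Cfg.Step.toState {φ' : PosDesign} {ψ' : NegDesign} {s s' : Cfg}
    (h : Cfg.Step φ ψ s s') (h' : actionAt φ' ψ' s.node = actionAt φ ψ s.node) :
    StepR (s.toState φ ψ φ' ψ') (s'.toState φ ψ φ' ψ') ∨
      StepS (s.toState φ ψ φ' ψ') (s'.toState φ ψ φ' ψ') := by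
  cases h with
  | cut a I e h he hf => exact Or.inl (Cfg.stepR_toState h he hf h')
  | free a I i J h hn hi =>
    have := StepS.mk (subAt φ' ψ' s.node) (s.toState φ ψ φ' ψ').env s.index a I i J
      (by rw [subAt_head_nil, h', h])
      (fun hA => by
        obtain ⟨e, he, hf⟩ := Cfg.accepts_toState.1 hA
        exact hn e he hf) hi
    rw [subAt_sub] at this
    exact Or.inr this

theorem Cfg.exists_of_stepR {s : Cfg} {σ : State} (h : StepR (s.toState φ ψ φ ψ) σ) :
    ∃ a I e, actionAt φ ψ s.node = PosAction.proper a I ∧ e ∈ s.cells ∧ e.focus φ ψ = a ∧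
      σ = (s.afterCut φ ψ a I e).toState φ ψ φ ψ := by
  generalize hσ : s.toState φ ψ φ ψ = σ₀ at h
  cases h with
  | mk D Ψ q a I χ h hχ hf =>
    cases hσ
    rw [subAt_head_nil] at h
    obtain ⟨e, he, rfl⟩ := hχ
    refine ⟨a, I, e, h, he, hf, ?_⟩
    refine Eq.trans ?_ (congrArg (fun E => (⟨subAt φ ψ (e.node I), E, s.index⟩ : State))
      (Cfg.toState_afterCut_env (e := e) h).symm)
    rfl

theorem Cfg.exists_of_stepS {s : Cfg} {σ : State} (h : StepS (s.toState φ ψ φ ψ) σ) :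
    ∃ s', Cfg.Step φ ψ s s' ∧ σ = s'.toState φ ψ φ ψ := by
  generalize hσ : s.toState φ ψ φ ψ = σ₀ at h
  cases h with
  | mk D Ψ q a I i J h hΨ hi =>
    cases hσ
    rw [subAt_head_nil] at h
    refine ⟨_, Cfg.Step.free s a I i J h (fun e he hf => hΨ ⟨_, ⟨e, he, rfl⟩, hf⟩) hi, ?_⟩
    rw [subAt_sub]
    rfl

theorem Reachable.exists_cfg {σ : State} (h : Reachable φ {ψ} σ) :
    ∃ s, Cfg.Steps φ ψ Cfg.init s ∧ σ = s.toState φ ψ φ ψ := by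
  induction h with
  | refl => exact ⟨Cfg.init, Relation.ReflTransGen.refl, (Cfg.toState_init rfl).symm⟩
  | tail _ hst ih =>
    obtain ⟨s, hs, rfl⟩ := ih
    rcases hst with hst | hst
    · obtain ⟨a, I, e, h, he, hf, rfl⟩ := Cfg.exists_of_stepR hst
      exact ⟨_, hs.tail (Cfg.Step.cut s a I e h he hf), rfl⟩
    · obtain ⟨s', hs', rfl⟩ := Cfg.exists_of_stepS hst
      exact ⟨s', hs.tail hs', rfl⟩

/-! ### The part of the designs which is visited -/

/-- The nodes which are visited during the exploration of `R`. -/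
def Visited (φ : PosDesign) (ψ : NegDesign) (R : Set (List Action)) (n : Node) : Prop :=
  ∃ s, Cfg.Steps φ ψ Cfg.init s ∧ (∃ r ∈ R, s.index <+: r) ∧ s.node = n

theorem Cfg.Steps.fired_visited {s : Cfg} (h : Cfg.Steps φ ψ Cfg.init s) {u : Node}
    (hu : u ∈ s.fired) :
    ∃ s', Cfg.Steps φ ψ Cfg.init s' ∧ s'.index <+: s.index ∧ s'.node = u := by
  induction h with
  | refl => exact hu.elim
  | @tail s s' hs hst ih =>
    have hp : s.index <+: s'.index := Cfg.Steps.index_prefix (Relation.ReflTransGen.single hst)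
    have hu' : u = s.node ∨ u ∈ s.fired := by cases hst <;> exact hu
    rcases hu' with rfl | hu'
    · exact ⟨s, hs, hp, rfl⟩
    · obtain ⟨x, hx, hxp, hxu⟩ := ih hu'
      exact ⟨x, hx, hxp.trans hp, hxu⟩

/-- A cell above `n` is entered only once `n` has been fired, at an index which is a prefix of the
present one. This closure makes the restriction to visited nodes a tree. -/
theorem Visited.parent (H : Contexts φ ψ G L) (h₀ : Cfg.init.Inv φ ψ G L)
    {R : Set (List Action)} {n : Node} {i : ℕ} {J : Ram} (h : Visited φ ψ R (n.ext i J)) :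
    Visited φ ψ R n := by
  obtain ⟨s, hs, ⟨r, hr, hp⟩, hn⟩ := h
  have hI := h₀.steps H hs
  have hu := hI.node_used
  rw [hn, Node.cell_ext] at hu
  obtain ⟨x, hx, hxp, hxn⟩ := hs.fired_visited (hI.used_pos _ _ hu)
  exact ⟨x, hx, ⟨r, hr, hxp.trans hp⟩, hxn⟩

open Classical in
/-- The restriction of a positive design to a set of nodes which is closed downwards. -/
noncomputable def PosDesign.restrict (D : PosDesign) (V : Path → Prop)
    (hV : ∀ p i J, V (p ++ [(i, J)]) → V p) : PosDesign where
  head p := if V p then D.head p else PosAction.omega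
  tree p i J h := by
    by_cases hp : V (p ++ [(i, J)])
    · rw [if_pos hp] at h
      rw [if_pos (hV _ _ _ hp)]
      exact D.tree p i J h
    · rw [if_neg hp] at h
      exact absurd rfl h

theorem PosDesign.restrict_subset (D : PosDesign) (V : Path → Prop)
    (hV : ∀ p i J, V (p ++ [(i, J)]) → V p) : D.restrict V hV ⊆ D := by
  intro p
  by_cases hp : V p
  · exact Or.inr (if_pos hp)
  · exact Or.inl (if_neg hp)

/-- The visited parts of `φ` and `ψ` are enough to produce the chronicles of `R`. -/
theorem exists_produces_visited (H : Contexts φ ψ G L) (h₀ : Cfg.init.Inv φ ψ G L)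
    {R : Set (List Action)} (hR : R ⊆ normalForm φ {ψ}) :
    ∃ φ₁ ψ₁, Produces φ ψ R φ₁ ψ₁ ∧
      ∀ n, actionAt φ₁ ψ₁ n ≠ PosAction.omega → Visited φ ψ R n := by
  have hpar : ∀ c p i J, Visited φ ψ R ⟨c, p ++ [(i, J)]⟩ → Visited φ ψ R ⟨c, p⟩ :=
    fun c p i J h => Visited.parent (n := ⟨c, p⟩) H h₀ h
  let φ₁ := φ.restrict (fun p => Visited φ ψ R ⟨none, p⟩) (hpar none)
  let ψ₁ : NegDesign :=
    ⟨ψ.focus, fun J => (ψ.branch J).restrict (fun p => Visited φ ψ R ⟨some J, p⟩) (hpar (some J))⟩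
  have hact : ∀ n, Visited φ ψ R n → actionAt φ₁ ψ₁ n = actionAt φ ψ n := by
    rintro ⟨_ | J, p⟩ h
    · exact if_pos h
    · exact if_pos h
  have hvis : ∀ n, actionAt φ₁ ψ₁ n ≠ PosAction.omega → Visited φ ψ R n := by
    rintro ⟨_ | J, p⟩ h
    · by_contra hn
      exact h (if_neg hn)
    · by_contra hn
      exact h (if_neg hn)
  -- Runs exploring `R` can be replayed in the restrictions, which keep the action of every visited
  -- node.
  have hreach : ∀ r ∈ R, ∀ s, Cfg.Steps φ ψ Cfg.init s → s.index <+: r →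
      Reachable φ₁ {ψ₁} (s.toState φ ψ φ₁ ψ₁) := by
    intro r hr s hs
    induction hs with
    | refl =>
      intro _
      rw [Cfg.toState_init (φ := φ) (ψ := ψ) (ψ' := ψ₁) rfl]
      exact Relation.ReflTransGen.refl
    | @tail s s' hs hst ih =>
      intro hp
      have hp' := (Cfg.Steps.index_prefix (Relation.ReflTransGen.single hst)).trans hp
      exact (ih hp').tail (hst.toState (hact _ ⟨s, hs, ⟨r, hr, hp'⟩, rfl⟩))
  have hhead : ∀ r ∈ R, ∀ s, Cfg.Steps φ ψ Cfg.init s → s.index <+: r →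
      (s.toState φ ψ φ₁ ψ₁).code.head [] = (s.toState φ ψ φ ψ).code.head [] := by
    intro r hr s hs hp
    change (subAt φ₁ ψ₁ s.node).head [] = (subAt φ ψ s.node).head []
    rw [subAt_head_nil, subAt_head_nil]
    exact hact _ ⟨s, hs, ⟨r, hr, hp⟩, rfl⟩
  refine ⟨φ₁, ψ₁, ⟨PosDesign.restrict_subset _ _ (hpar none),
    ⟨rfl, fun J => PosDesign.restrict_subset _ _ (hpar (some J))⟩, fun r hr => ?_⟩, hvis⟩
  rcases hR hr with ((⟨σ, a, I, hσ, hh, hA, hq⟩ | ⟨σ, hσ, hh, hq⟩) | ⟨σ, hσ, hh, hq⟩) |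
    ⟨σ, hσ, hD, hq⟩ <;> obtain ⟨s, hs, rfl⟩ := hσ.exists_cfg <;>
    have hp : s.index <+: r := hq ▸ List.prefix_append _ _
  · refine Or.inl (Or.inl (Or.inl ⟨_, a, I, hreach r hr s hs hp, (hhead r hr s hs hp).trans hh,
      fun hA' => hA ?_, hq⟩))
    exact Cfg.accepts_toState.2 (Cfg.accepts_toState.1 hA')
  · exact Or.inl (Or.inl (Or.inr ⟨_, hreach r hr s hs hp, (hhead r hr s hs hp).trans hh, hq⟩))
  · exact Or.inl (Or.inr ⟨_, hreach r hr s hs hp, (hhead r hr s hs hp).trans hh, hq⟩)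
  · refine Or.inr ⟨_, hreach r hr s hs hp, ?_, hq⟩
    -- The infinite run is lifted to configurations step by step. Rule (R) does not change the
    -- index, so all the nodes it meets count as visited.
    obtain ⟨f, hf0, hf⟩ := hD
    have hstep : ∀ (k : ℕ) (x : {x : Cfg // Cfg.Steps φ ψ Cfg.init x ∧ x.index <+: r ∧
        f k = x.toState φ ψ φ ψ}), ∃ y : {y : Cfg // Cfg.Steps φ ψ Cfg.init y ∧ y.index <+: r ∧
        f (k + 1) = y.toState φ ψ φ ψ},
        StepR (x.1.toState φ ψ φ₁ ψ₁) (y.1.toState φ ψ φ₁ ψ₁) := by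
      rintro k ⟨x, hx, hxp, hxf⟩
      have hst := hf k
      rw [hxf] at hst
      obtain ⟨a, I, e, h, he, hfe, hy⟩ := Cfg.exists_of_stepR hst
      exact ⟨⟨x.afterCut φ ψ a I e, hx.tail (Cfg.Step.cut x a I e h he hfe), hxp, hy⟩,
        Cfg.stepR_toState h he hfe (hact _ ⟨x, hx, ⟨r, hr, hxp⟩, rfl⟩)⟩
    choose next hnext using hstep
    let g : ∀ k, {x : Cfg // Cfg.Steps φ ψ Cfg.init x ∧ x.index <+: r ∧
        f k = x.toState φ ψ φ ψ} := fun k => Nat.rec ⟨s, hs, hp, hf0⟩ (fun k x => next k x) k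
    exact ⟨fun k => (g k).1.toState φ ψ φ₁ ψ₁, rfl, fun k => hnext k (g k)⟩

/-- No transition leaves a state whose code is `Ω`. This is what makes `φ₀` different from `Ω`. -/
theorem normalForm_of_head_omega {φ : PosDesign} {Ψ : Set NegDesign}
    (h : φ.head [] = PosAction.omega) {r : List Action} (hr : r ∈ normalForm φ Ψ) :
    r = [Action.pos PosAction.omega] := by
  have key : ∀ σ, Reachable φ Ψ σ → σ = ⟨φ, Ψ, []⟩ := by
    intro σ hσ
    rcases Relation.ReflTransGen.cases_head hσ with rfl | ⟨τ, hτ, -⟩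
    · rfl
    · rcases hτ with hτ | hτ <;> cases hτ <;> simp_all
  rcases hr with ((⟨σ, a, I, hσ, hh, -, hq⟩ | ⟨σ, hσ, -, hq⟩) | ⟨σ, hσ, hh, hq⟩) |
    ⟨σ, hσ, -, hq⟩ <;> obtain rfl := key σ hσ
  · simp_all
  · exact hq
  · simp_all
  · exact hq

theorem actionAt_of_subset {φ₀ φ₁ : PosDesign} {ψ₀ ψ₁ : NegDesign} (hφ : φ₀ ⊆ φ₁) (hψ : ψ₀ ⊆ ψ₁)
    {n : Node} (h : actionAt φ₀ ψ₀ n ≠ PosAction.omega) :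
    actionAt φ₁ ψ₁ n ≠ PosAction.omega := by
  obtain ⟨_ | J, p⟩ := n
  · exact fun h' => (hφ p).elim h fun h'' => h (h''.trans h')
  · exact fun h' => (hψ.2 J p).elim h fun h'' => h (h''.trans h')

/-- The pull-back of a set of chronicles with determined ramifications consists of slices, and
each of its occurrences is visited exactly once. -/
theorem IsPullback.slices {Γ Λ : Finset Address} {ξ : Address} (hφ : PosTyped φ Γ)
    (hψ : NegTyped ψ ξ Λ) (H : Contexts φ ψ G L) (h₀ : Cfg.init.Inv φ ψ G L)
    {R : Set (List Action)} (hdet : DetRam R) (hR : R ⊆ normalForm φ {ψ})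
    (hne : ∃ r ∈ R, r ≠ [Action.pos PosAction.omega]) {φ₀ : PosDesign} {ψ₀ : NegDesign}
    (h : IsPullback φ ψ R φ₀ ψ₀) : φ₀.IsSlice ∧ ψ₀.IsSlice ∧ VisitedOnce φ ψ R φ₀ ψ₀ := by
  obtain ⟨φ₁, ψ₁, hprod, hvis₁⟩ := exists_produces_visited H h₀ hR
  obtain ⟨hφ₁, hψ₁⟩ := h.2 φ₁ ψ₁ hprod
  obtain ⟨hφ₀, hψ₀, hR₀⟩ := h.1
  have hvis : ∀ n, actionAt φ₀ ψ₀ n ≠ PosAction.omega → Visited φ ψ R n :=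
    fun n hn => hvis₁ n (actionAt_of_subset hφ₁ hψ₁ hn)
  have huniq : ∀ n n', actionAt φ₀ ψ₀ n ≠ PosAction.omega → actionAt φ₀ ψ₀ n' ≠ PosAction.omega →
      n.cell = n'.cell → n = n' := by
    intro n n' hn hn' hc
    obtain ⟨s, hs, hr, rfl⟩ := hvis n hn
    obtain ⟨s', hs', hr', rfl⟩ := hvis n' hn'
    rw [Cfg.eq_of_cell_eq H h₀ hdet hs hs' hr hr' hc]
  have hmult : ∀ (n : Node) (i : ℕ) (J₁ J₂ : Ram),
      actionAt φ₀ ψ₀ (n.ext i J₁) ≠ PosAction.omega →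
      actionAt φ₀ ψ₀ (n.ext i J₂) ≠ PosAction.omega → J₁ = J₂ := by
    intro n i J₁ J₂ h₁ h₂
    -- Nodes differing only in their last ramification lie in the same cell.
    simpa [Node.ext] using huniq _ _ h₁ h₂ (by simp)
  refine ⟨⟨⟨⟨Γ, hφ.of_subset hφ₀⟩, fun hΩ => ?_⟩, fun p => hmult ⟨none, p⟩⟩,
    ⟨⟨ξ, Λ, hψ.of_subset hψ₀⟩, fun J₁ J₂ h₁ h₂ => ?_, fun J p => hmult ⟨some J, p⟩⟩, ?_⟩
  · obtain ⟨r, hr, hrΩ⟩ := hne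
    exact hrΩ (normalForm_of_head_omega hΩ (hR₀ hr))
  · have := huniq ⟨some J₁, []⟩ ⟨some J₂, []⟩ h₁ h₂ rfl
    simpa using this
  · rintro σ n ⟨hn, hσ⟩
    obtain ⟨s, hs, hr, rfl⟩ := hvis n hn
    have ht := hs.tokenReach H h₀
    have huq : ∀ k t, VisitAt φ ψ R σ s.node k t →
        t = ⟨σ, s.node, s.bindings, s.index⟩ ∧ ((σ = Sign.plus ∧ k = 2 * s.time) ∨
          (σ = Sign.minus ∧ k + 1 = 2 * s.time)) := by
      rintro k t ⟨hk, hkr, rfl, hkn⟩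
      obtain ⟨s', hs', ht', hk'⟩ := hk.exists_cfg H h₀
      rw [ht'] at hkr hkn
      obtain rfl := Cfg.eq_of_cell_eq H h₀ hdet hs' hs hkr hr (congrArg Node.cell hkn)
      exact ⟨ht', hk'⟩
    cases σ with
    | plus =>
      refine ⟨(_, _), ⟨ht.1, hr, rfl, rfl⟩, ?_⟩
      rintro ⟨k, t⟩ hv
      obtain ⟨rfl, ⟨-, rfl⟩ | ⟨h, -⟩⟩ := huq k t hv
      · rfl
      · cases h
    | minus =>
      refine ⟨(_, _), ⟨ht.2 (hσ rfl), hr, rfl, rfl⟩, ?_⟩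
      rintro ⟨k, t⟩ hv
      obtain ⟨rfl, ⟨h, -⟩ | ⟨-, h⟩⟩ := huq k t hv
      · cases h
      · obtain rfl : k = 2 * s.time - 1 := by omega
        rfl

end

end Ludics

theorem mainTheorem9 (ξ : Ludics.Address) (Λ₁ Λ₂ : Finset Ludics.Address)
    (φ : Ludics.PosDesign) (ψ : Ludics.NegDesign)
    (hξ : ξ ∉ Λ₁) (hΛ : Disjoint Λ₁ Λ₂)
    (hwf : Ludics.WellFormed (insert ξ (Λ₁ ∪ Λ₂)))
    (hφ : Ludics.PosTyped φ (insert ξ Λ₁)) (hψ : Ludics.NegTyped ψ ξ Λ₂) :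
    (∀ r ∈ Ludics.normalForm φ {ψ}, r ≠ [Ludics.Action.pos Ludics.PosAction.omega] →
      ∀ (φ₀ : Ludics.PosDesign) (ψ₀ : Ludics.NegDesign),
        Ludics.IsPullback φ ψ {r} φ₀ ψ₀ →
          φ₀.IsSlice ∧ ψ₀.IsSlice ∧ Ludics.VisitedOnce φ ψ {r} φ₀ ψ₀) ∧
    (∀ S : Ludics.PosDesign, S.IsSlice → S.chronicles ⊆ Ludics.normalForm φ {ψ} →
      ∀ (φ₀ : Ludics.PosDesign) (ψ₀ : Ludics.NegDesign),
        Ludics.IsPullback φ ψ S.chronicles φ₀ ψ₀ →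
          φ₀.IsSlice ∧ ψ₀.IsSlice ∧ Ludics.VisitedOnce φ ψ S.chronicles φ₀ ψ₀) := by
  obtain ⟨G, L, H, hG, hL⟩ := Ludics.exists_contexts hφ hψ
  obtain rfl := hψ.1
  have h₀ := Ludics.Cfg.inv_init H hG hL hΛ hwf
  refine ⟨fun r hr hrΩ φ₀ ψ₀ h => ?_, fun S hS hSR φ₀ ψ₀ h => ?_⟩
  · exact h.slices hφ hψ H h₀ (Ludics.DetRam.singleton r) (Set.singleton_subset_iff.2 hr)
      ⟨r, rfl, hrΩ⟩
  · refine h.slices hφ hψ H h₀ hS.2.detRam hSR ?_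
    -- The root of `S` alone is a chronicle other than `Ω`.
    cases hh : S.head [] with
    | omega => exact absurd hh hS.1.2
    | daimon => exact ⟨_, Ludics.PosDesign.IsChronicle.daimon S hh, by simp⟩
    | proper a I => exact ⟨_, Ludics.PosDesign.IsChronicle.proper S a I hh, by simp⟩
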